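/- Let $p$ be an odd prime, let $g=\begin{pmatrix}1&1\\0&1\end{pmatrix}$ act on $V=\mathbb F_p^2$ with basis $v_1,v_2$ (so ${}^gv_1=v_1$, ${}^gv_2=v_1+v_2$), let $G=\langle g\rangle$, a cyclic group of order $p$, and let $A=S(V)\rtimes G$, graded by $\deg v=1$ for $v\in V$ and $\deg h=0$ for $h\in G$. Put $A^e=A\otimes A^{op}$ and $\overline{\mathbb F_pG}=\mathbb F_pG/\mathbb F_p\cdot 1$. Let $X_\bullet=P_\bullet\otimes^G K_\bullet$ be the twisted product of the periodic resolution $P_\bullet$ of $\mathbb F_pG$ (each $P_i=\mathbb F_pG\otimes\mathbb F_pG$, with differentials $g\otimes1-1\otimes g$ for odd $i$ and $\sum_{\ell=0}^{p-1}g^{\ell}\otimes g^{p-1-\ell}$ for even $i>0$, and $1\otimes 1$ of group degree $1$ for even $i$ and $g$ for odd $i$) with the Koszul resolution $K_\bullet$ of $S(V)$, and let $Y_\bullet=\overline{B(G)}_\bullet\otimes^G K_\bullet$ be the corresponding twisted product with the reduced bar resolution of $\mathbb F_pG$. Thus $$X_2=(A\otimes A)\oplus(A\otimes V\otimes A)\oplus(A\otimes\textstyle\bigwedge^2V\otimes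 A),\qquad Y_2=(A\otimes\overline{\mathbb F_pG}^{\otimes2}\otimes A)\oplus(A\otimes\overline{\mathbb F_pG}\otimes V\otimes A)\oplus(A\otimes\textstyle\bigwedge^2V\otimes A).$$ Let $\pi_2:Y_2\to X_2$ be the $A$-bimodule map with, for $0\le r,s\le p-1$, $$\pi_2(1\otimes g^s\otimes g^r\otimes1)=1\otimes g^{s+r-p},\quad \pi_2(1\otimes g^s\otimes v\otimes1)=\sum_{\ell=0}^{s-1}g^{s-1-\ell}\otimes{}^{g^\ell}v\otimes g^\ell,\quad \pi_2(1\otimes u\wedge w\otimes1)=1\otimes u\wedge w\otimes1,$$ where a negative power of $g$ is read as $0$. The space $\mathrm{HH}^2_{-1}(A)$ is computed as the space of 2-cocycles of graded degree $-1$ in $\mathrm{Hom}_{A^e}(X_\bullet,A)$ modulo the coboundaries of 1-cochains of graded degree $-1$. For $a=(a_0,\dots,a_{p-1})$ and $b=(b_0,\dots,b_{p-1})$ in $\mathbb F_p^p$ let $\gamma_X=\gamma_X^{a,b}\in\mathrm{Hom}_{A^e}(X_2,A)$ be the distinguished cochain that vanishes on $A\otimes A$ and satisfies $$\gamma_X(v_1)=\sum_{\ell=0}^{p-1}b_\ell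 g^{\ell+1},\qquad \gamma_X(v_2)=\sum_{\ell=1}^{p-1}a_\ell g^{\ell+1},\qquad \gamma_X(v_1\wedge v_2)=a_0v_1+\sum_{\ell=0}^{p-1}\ell\,b_\ell\,v_2g^\ell .$$ Lemma. (i) Every $\gamma_X^{a,b}$ is a 2-cocycle on $X_\bullet$ of graded degree $-1$, and every class in $\mathrm{HH}^2_{-1}(A)$ is represented by $\gamma_X^{a,b}$ for exactly one pair $(a,b)$. (ii) For all $a,b$, the transferred cochain $\gamma=\gamma_X^{a,b}\circ\pi_2$ is a 2-cocycle on $Y_\bullet$ of graded degree $-1$, and for all $0\le i,j\le p-1$ $$\gamma(g^i\otimes g^j)=0,\qquad \gamma(g^i\otimes v_1)=i\Big(\sum_{\ell=0}^{p-1}b_\ell g^\ell\Big)g^i,$$ $$\gamma(g^i\otimes v_2)=\binom i2\Big(\sum_{\ell=0}^{p-1}b_\ell g^\ell\Big)g^i+i\Big(\sum_{\ell=1}^{p-1}a_\ell g^\ell\Big)g^i,\qquad \gamma(v_1\wedge v_2)=a_0v_1+\sum_{\ell=0}^{p-1}\ell\,b_\ell\,v_2g^\ell .$$ -/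

import Mathlib

open scoped TensorProduct
open MulOpposite

noncomputable section

namespace TransvectionHH

/-! ### The group `G`, its action on `V` and on `S(V)`, and the skew group algebra `A` -/

/-- The vector space `V = 𝔽_p²`. -/
abbrev V (p : ℕ) : Type := Fin 2 → ZMod p

/-- The basis vector `v₁`. -/
def v₁ (p : ℕ) : V p := ![1, 0]

/-- The basis vector `v₂`. -/
def v₂ (p : ℕ) : V p := ![0, 1]

/-- The transvection with matrix `(1 1; 0 1)`. -/
def transvection (p : ℕ) : GL (Fin 2) (ZMod p) where
  val := !![1, 1; 0, 1]
  inv := !![1, -1; 0, 1]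
  val_inv := by ext i j; fin_cases i <;> fin_cases j <;> simp [Matrix.mul_apply]
  inv_val := by ext i j; fin_cases i <;> fin_cases j <;> simp [Matrix.mul_apply]

/-- The cyclic group `G` generated by the transvection. -/
abbrev G (p : ℕ) : Type := Subgroup.zpowers (transvection p)

/-- The generator `g` of `G`. -/
def g (p : ℕ) : G p := ⟨transvection p, Subgroup.mem_zpowers _⟩

/-- The linear action `v ↦ ʰv` of `h ∈ G` on column vectors. -/
def act {p : ℕ} (h : G p) : V p →ₗ[ZMod p] V p :=
  Matrix.mulVecLin (h : GL (Fin 2) (ZMod p)).val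

lemma act_one {p : ℕ} : act (1 : G p) = LinearMap.id := by
  ext; simp [act]

lemma act_mul {p : ℕ} (h k : G p) : act (h * k) = act h ∘ₗ act k := by
  simp [act, Matrix.mulVecLin_mul]

/-- The symmetric algebra `S(V) = 𝔽_p[v₁, v₂]`. -/
abbrev S (p : ℕ) : Type := MvPolynomial (Fin 2) (ZMod p)

/-- The inclusion of `V` in `S(V)` as the linear forms. -/
def toS (p : ℕ) : V p →ₗ[ZMod p] S p :=
  Fintype.linearCombination (ZMod p) (MvPolynomial.X : Fin 2 → S p)

/-- The algebra endomorphism of `S(V)` that extends the action of `h` on `V`. -/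
def actS {p : ℕ} (h : G p) : S p →ₐ[ZMod p] S p :=
  MvPolynomial.aeval fun j => toS p (act h (Pi.single j 1))

lemma toS_single {p : ℕ} (j : Fin 2) : toS p (Pi.single j 1) = MvPolynomial.X j := by
  simp [toS, Fintype.linearCombination_apply_single]

lemma actS_toS {p : ℕ} (h : G p) (v : V p) : actS h (toS p v) = toS p (act h v) := by
  have : (actS h).toLinearMap ∘ₗ toS p = toS p ∘ₗ act h := by
    refine LinearMap.pi_ext' fun j => LinearMap.ext_ring ?_
    simp [toS_single, actS]
  exact LinearMap.congr_fun this v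

/-- `G` acts on `S(V)` by algebra automorphisms. -/
instance actionS (p : ℕ) : MulSemiringAction (G p) (S p) where
  smul h f := actS h f
  one_smul f := by
    have : actS (1 : G p) = AlgHom.id (ZMod p) (S p) := by
      ext j : 1; simp [actS, act_one, toS_single]
    exact congrArg (fun φ => φ f) this
  mul_smul h k f := by
    have : actS (h * k) = (actS h).comp (actS k) := by
      ext j : 1
      rw [AlgHom.comp_apply, ← toS_single, actS_toS, actS_toS, actS_toS, act_mul,
        LinearMap.comp_apply]
    exact congrArg (fun φ => φ f) this
  smul_zero h := map_zero (actS h)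
  smul_add h := map_add (actS h)
  smul_one h := map_one (actS h)
  smul_mul h := map_mul (actS h)

instance actionS_comm (p : ℕ) : SMulCommClass (G p) (ZMod p) (S p) where
  smul_comm h c f := map_smul (actS h) c f

/-- The skew group algebra `A = S(V) ⋊ G`, with `(s h) (s' h') = s (ʰs') (h h')`. -/
def A (p : ℕ) : Type := SkewMonoidAlgebra (S p) (G p)

instance ringA (p : ℕ) : Ring (A p) := inferInstanceAs (Ring (SkewMonoidAlgebra (S p) (G p)))

instance algebraA (p : ℕ) : Algebra (ZMod p) (A p) :=
  inferInstanceAs (Algebra (ZMod p) (SkewMonoidAlgebra (S p) (G p)))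

/-- A group element, as an element of `A`. -/
def ofG {p : ℕ} (h : G p) : A p := (SkewMonoidAlgebra.single h 1 : SkewMonoidAlgebra (S p) (G p))

/-- The inclusion of `V` in `A`. -/
def ofV (p : ℕ) : V p →ₗ[ZMod p] A p where
  toFun v := (SkewMonoidAlgebra.single 1 (toS p v) : SkewMonoidAlgebra (S p) (G p))
  map_add' u v := by rw [map_add]; exact SkewMonoidAlgebra.single_add _ _ _
  map_smul' c v := by rw [map_smul]; exact (SkewMonoidAlgebra.smul_single _ _ _).symm

/-- The commutation rule `h v = ʰv h` in `A`. -/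
lemma ofG_mul_ofV {p : ℕ} (h : G p) (v : V p) :
    ofG h * ofV p v = ofV p (act h v) * ofG h := by
  have h1 : ofG h * ofV p v
      = (SkewMonoidAlgebra.single (h * 1) (1 * actS h (toS p v)) : SkewMonoidAlgebra (S p) (G p)) :=
    SkewMonoidAlgebra.single_mul_single
  have h2 : ofV p (act h v) * ofG h
      = (SkewMonoidAlgebra.single (1 * h) (toS p (act h v) * (1 : G p) • (1 : S p)) :
          SkewMonoidAlgebra (S p) (G p)) :=
    SkewMonoidAlgebra.single_mul_single
  rw [h1, h2, actS_toS, mul_one, one_mul, one_mul, one_smul, mul_one]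

lemma ofG_mul {p : ℕ} (h k : G p) : ofG (h * k) = ofG h * ofG k := by
  have h1 : ofG h * ofG k
      = (SkewMonoidAlgebra.single (h * k) (1 * h • (1 : S p)) : SkewMonoidAlgebra (S p) (G p)) :=
    SkewMonoidAlgebra.single_mul_single
  rw [h1, smul_one, one_mul, ofG]

lemma ofG_one {p : ℕ} : ofG (1 : G p) = 1 := rfl

/-- `x ∈ A` is homogeneous of degree `d`, where vectors have degree `1` and group elements
have degree `0`. (For `d < 0` this forces `x = 0`.) -/
def IsHomogA {p : ℕ} (d : ℤ) (x : A p) : Prop :=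
  ∀ h : G p, ∀ m ∈ (SkewMonoidAlgebra.coeff x h).support, (m.degree : ℤ) = d

/-! ### Bimodules -/

/-- The enveloping algebra `Aᵉ = A ⊗ Aᵒᵖ`. -/
def Ae (p : ℕ) : Type := A p ⊗[ZMod p] (A p)ᵐᵒᵖ

instance ringAe (p : ℕ) : Ring (Ae p) := inferInstanceAs (Ring (A p ⊗[ZMod p] (A p)ᵐᵒᵖ))

instance algebraAe (p : ℕ) : Algebra (ZMod p) (Ae p) :=
  inferInstanceAs (Algebra (ZMod p) (A p ⊗[ZMod p] (A p)ᵐᵒᵖ))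

/-- The element `a ⊗ b` of `Aᵉ`. -/
def env {p : ℕ} (a b : A p) : Ae p := (a ⊗ₜ op b : A p ⊗[ZMod p] (A p)ᵐᵒᵖ)

lemma env_add_left {p : ℕ} (a a' b : A p) : env (a + a') b = env a b + env a' b :=
  TensorProduct.add_tmul _ _ _

lemma env_add_right {p : ℕ} (a b b' : A p) : env a (b + b') = env a b + env a b' :=
  TensorProduct.tmul_add _ _ _

lemma env_smul_left {p : ℕ} (c : ZMod p) (a b : A p) : env (c • a) b = c • env a b := rfl

lemma env_smul_right {p : ℕ} (c : ZMod p) (a b : A p) : env a (c • b) = c • env a b :=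
  (TensorProduct.smul_tmul c a (op b)).symm

lemma env_mul {p : ℕ} (a b a' b' : A p) : env a b * env a' b' = env (a * a') (b' * b) :=
  Algebra.TensorProduct.tmul_mul_tmul _ _ _ _

/-- `A` as an `Aᵉ`-module: `(a ⊗ b) • x = a x b`. -/
instance moduleAeA (p : ℕ) : Module (Ae p) (A p) :=
  (TensorProduct.Algebra.module : Module (A p ⊗[ZMod p] (A p)ᵐᵒᵖ) (A p))

lemma env_smul {p : ℕ} (a b x : A p) : env a b • x = a * x * b := by
  change a • (op b) • x = _
  simp [mul_assoc]

instance towerAeA (p : ℕ) : IsScalarTower (ZMod p) (Ae p) (A p) where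
  smul_assoc c x y := by
    change TensorProduct.Algebra.moduleAux _ _ = _ • TensorProduct.Algebra.moduleAux _ _
    exact LinearMap.congr_fun (map_smul TensorProduct.Algebra.moduleAux c x) y

instance commAeA (p : ℕ) : SMulCommClass (ZMod p) (Ae p) (A p) where
  smul_comm c x y := by
    change _ • TensorProduct.Algebra.moduleAux _ _ = TensorProduct.Algebra.moduleAux _ _
    exact (map_smul (TensorProduct.Algebra.moduleAux x) c y).symm

instance commAeA' (p : ℕ) : SMulCommClass (Ae p) (ZMod p) (A p) :=
  SMulCommClass.symm _ _ _

/-- The free `A`-bimodule `A ⊗ M ⊗ A` on a vector space `M`, written as the `Aᵉ`-module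
`Aᵉ ⊗ M`. -/
def Bim (p : ℕ) (M : Type) [AddCommGroup M] [Module (ZMod p) M] : Type := Ae p ⊗[ZMod p] M

section bimodule

variable {p : ℕ} {M M' N : Type} [AddCommGroup M] [Module (ZMod p) M]
  [AddCommGroup M'] [Module (ZMod p) M'] [AddCommGroup N] [Module (ZMod p) N]

instance : AddCommGroup (Bim p M) := inferInstanceAs (AddCommGroup (Ae p ⊗[ZMod p] M))

instance : Module (ZMod p) (Bim p M) := inferInstanceAs (Module (ZMod p) (Ae p ⊗[ZMod p] M))

instance : Module (Ae p) (Bim p M) := inferInstanceAs (Module (Ae p) (Ae p ⊗[ZMod p] M))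

instance : IsScalarTower (ZMod p) (Ae p) (Bim p M) :=
  inferInstanceAs (IsScalarTower (ZMod p) (Ae p) (Ae p ⊗[ZMod p] M))

instance : SMulCommClass (ZMod p) (Ae p) (Bim p M) :=
  inferInstanceAs (SMulCommClass (ZMod p) (Ae p) (Ae p ⊗[ZMod p] M))

instance : SMulCommClass (Ae p) (ZMod p) (Bim p M) := SMulCommClass.symm _ _ _

/-- The linear map `m ↦ a ⊗ m ⊗ b` from `M` to `A ⊗ M ⊗ A`. -/
def triL (a b : A p) : M →ₗ[ZMod p] Bim p M :=
  TensorProduct.mk (ZMod p) (Ae p) M (env a b)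

/-- The element `a ⊗ m ⊗ b` of `A ⊗ M ⊗ A`. -/
def tri (a : A p) (m : M) (b : A p) : Bim p M := triL a b m

lemma triL_apply (a b : A p) (m : M) : triL a b m = tri a m b := rfl

lemma tri_def (a b : A p) (m : M) :
    tri a m b = (env a b ⊗ₜ m : Ae p ⊗[ZMod p] M) := rfl

lemma tri_add_left (a a' b : A p) (m : M) : tri (a + a') m b = tri a m b + tri a' m b := by
  simp only [tri_def, env_add_left, TensorProduct.add_tmul]; rfl

lemma tri_add_mid (a b : A p) (m m' : M) : tri a (m + m') b = tri a m b + tri a m' b :=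
  map_add (triL a b) m m'

lemma tri_add_right (a b b' : A p) (m : M) : tri a m (b + b') = tri a m b + tri a m b' := by
  simp only [tri_def, env_add_right, TensorProduct.add_tmul]; rfl

lemma tri_smul_left (c : ZMod p) (a b : A p) (m : M) : tri (c • a) m b = c • tri a m b := rfl

lemma tri_smul_mid (c : ZMod p) (a b : A p) (m : M) : tri a (c • m) b = c • tri a m b :=
  map_smul (triL a b) c m

lemma tri_smul_right (c : ZMod p) (a b : A p) (m : M) : tri a m (c • b) = c • tri a m b := by
  simp only [tri_def, env_smul_right]; rfl

lemma tri_zero (a b : A p) : tri a (0 : M) b = 0 := map_zero (triL a b)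

lemma smul_tri (x y a b : A p) (m : M) :
    env x y • tri a m b = tri (x * a) m (b * y) := by
  rw [tri_def, tri_def, ← env_mul]; rfl

/-- The bimodule map on `A ⊗ M ⊗ A` with prescribed values `φ m` at `1 ⊗ m ⊗ 1`. -/
def bimLift {N : Type} [AddCommMonoid N] [Module (ZMod p) N] [Module (Ae p) N] [IsScalarTower (ZMod p) (Ae p) N]
    [SMulCommClass (ZMod p) (Ae p) N] [SMulCommClass (Ae p) (ZMod p) N]
    (φ : M →ₗ[ZMod p] N) : Bim p M →ₗ[Ae p] N :=
  TensorProduct.AlgebraTensorModule.lift (LinearMap.toSpanSingleton (Ae p) (M →ₗ[ZMod p] N) φ)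

lemma bimLift_tri {N : Type} [AddCommMonoid N] [Module (ZMod p) N] [Module (Ae p) N] [IsScalarTower (ZMod p) (Ae p) N]
    [SMulCommClass (ZMod p) (Ae p) N] [SMulCommClass (Ae p) (ZMod p) N]
    (φ : M →ₗ[ZMod p] N) (a b : A p) (m : M) :
    bimLift φ (tri a m b) = env a b • φ m := rfl

/-- The part of degree `d` of `A ⊗ M ⊗ A`, for a vector space `M` whose homogeneous elements of
degree `j` form `gr j`. -/
def bimDeg (gr : ℤ → Set M) (d : ℤ) : Submodule (ZMod p) (Bim p M) :=
  Submodule.span (ZMod p) {x | ∃ (r j s : ℤ) (a : A p) (m : M) (b : A p),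
    IsHomogA r a ∧ m ∈ gr j ∧ IsHomogA s b ∧ r + j + s = d ∧ x = tri a m b}

/-- The bimodule map `f : A ⊗ M ⊗ A → A` has graded degree `-1`. -/
def IsDegNegOne (gr : ℤ → Set M) (f : Bim p M →ₗ[Ae p] A p) : Prop :=
  ∀ d : ℤ, ∀ x ∈ bimDeg (p := p) gr d, IsHomogA (d - 1) (f x)

/-- The linear map `u ∧ w ↦ B u w - B w u` on `⋀²V`, for a bilinear map `B`. -/
def wedgeLift (B : V p →ₗ[ZMod p] V p →ₗ[ZMod p] N) : ⋀[ZMod p]^2 (V p) →ₗ[ZMod p] N :=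
  exteriorPower.alternatingMapLinearEquiv
    { toFun := fun u => B (u 0) (u 1) - B (u 1) (u 0)
      map_update_add' := by
        intro _ u i x y
        fin_cases i <;> simp [Function.update] <;> abel
      map_update_smul' := by
        intro _ u i c x
        fin_cases i <;> simp [Function.update, smul_sub]
      map_eq_zero_of_eq' := by
        intro u i j h hij
        fin_cases i <;> fin_cases j <;> simp_all }

/-- The element `u ∧ w` of `⋀²V`. -/
def wedge (u w : V p) : ⋀[ZMod p]^2 (V p) := exteriorPower.ιMulti (ZMod p) 2 ![u, w]

lemma wedgeLift_wedge (B : V p →ₗ[ZMod p] V p →ₗ[ZMod p] N) (u w : V p) :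
    wedgeLift B (wedge u w) = B u w - B w u := by
  simp [wedgeLift, wedge]

/-- The diagonal action of `h ∈ G` on `⋀²V`. -/
def actW (h : G p) : ⋀[ZMod p]^2 (V p) →ₗ[ZMod p] ⋀[ZMod p]^2 (V p) := exteriorPower.map 2 (act h)

/-- The Koszul differential on `⋀¹V`, placed next to a generator `m` of group degree `h`:
`v ↦ ʰv ⊗ m ⊗ 1 - 1 ⊗ m ⊗ v`. -/
def koszul₁ (h : G p) (m : M) : V p →ₗ[ZMod p] Bim p M where
  toFun v := tri (ofV p (act h v)) m 1 - tri 1 m (ofV p v)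
  map_add' u v := by
    simp only [map_add, tri_add_left, tri_add_right]; abel
  map_smul' c v := by
    simp only [map_smul, tri_smul_left, tri_smul_right, RingHom.id_apply, smul_sub]

/-- The Koszul differential on `⋀²V`, placed next to a generator of group degree `h`, where `j v`
stands for that generator next to `v`:
`u ∧ w ↦ ʰu ⊗ j w ⊗ 1 - ʰw ⊗ j u ⊗ 1 + 1 ⊗ j u ⊗ w - 1 ⊗ j w ⊗ u`. -/
def koszul₂ (h : G p) (j : V p →ₗ[ZMod p] M) : ⋀[ZMod p]^2 (V p) →ₗ[ZMod p] Bim p M :=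
  wedgeLift (LinearMap.mk₂ (ZMod p)
    (fun u w => tri (ofV p (act h u)) (j w) 1 + tri 1 (j u) (ofV p w))
    (by intro u u' w; simp only [map_add, tri_add_left, tri_add_mid]; abel)
    (by intro c u w; simp only [map_smul, tri_smul_left, tri_smul_mid, smul_add])
    (by intro u w w'; simp only [map_add, tri_add_right, tri_add_mid]; abel)
    (by intro c u w; simp only [map_smul, tri_smul_right, tri_smul_mid, smul_add]))

lemma koszul₂_wedge (h : G p) (j : V p →ₗ[ZMod p] M) (u w : V p) :
    koszul₂ h j (wedge u w) = tri (ofV p (act h u)) (j w) 1 + tri 1 (j u) (ofV p w)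
      - (tri (ofV p (act h w)) (j u) 1 + tri 1 (j w) (ofV p u)) := by
  simp [koszul₂, wedgeLift_wedge]

lemma wedge_ext {f f' : ⋀[ZMod p]^2 (V p) →ₗ[ZMod p] N}
    (h : ∀ u w, f (wedge u w) = f' (wedge u w)) : f = f' := by
  refine exteriorPower.linearMap_ext (AlternatingMap.ext fun u => ?_)
  have := h (u 0) (u 1)
  rw [wedge, show ![u 0, u 1] = u by ext i; fin_cases i <;> rfl] at this
  exact this

end bimodule

/-! ### The periodic-twisted-Koszul resolution `X = P ⊗ᴳ K` in degrees 1, 2, 3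

`X_n` is the sum over `i + j = n` of `X_{i,j} = A ⊗ ⋀ʲV ⊗ A`. It is written as the free bimodule
on the sum of the `⋀ʲV`, in the order `j = 0, 1, 2`. As `dim V = 2`, `⋀³V = 0`. The differential
is `d_P ⊗ 1 + (-1)ⁱ 1 ⊗ d_K`, under `X_{i,j} ≅ A ⊗ ⋀ʲV ⊗ A`. The generator `1 ⊗ 1` of `P_i` has
group degree `1` for even `i` and `g` for odd `i`. -/

/-- The generators `⋀⁰V ⊕ ⋀¹V` of `X₁ = X_{1,0} ⊕ X_{0,1}`. -/
abbrev GenX₁ (p : ℕ) : Type := ZMod p × V p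

/-- The generators `⋀⁰V ⊕ ⋀¹V ⊕ ⋀²V` of `X₂ = X_{2,0} ⊕ X_{1,1} ⊕ X_{0,2}`. -/
abbrev GenX₂ (p : ℕ) : Type := ZMod p × V p × ⋀[ZMod p]^2 (V p)

/-- The generators `⋀⁰V ⊕ ⋀¹V ⊕ ⋀²V` of `X₃ = X_{3,0} ⊕ X_{2,1} ⊕ X_{1,2}`. -/
abbrev GenX₃ (p : ℕ) : Type := ZMod p × V p × ⋀[ZMod p]^2 (V p)

abbrev X₁ (p : ℕ) : Type := Bim p (GenX₁ p)
abbrev X₂ (p : ℕ) : Type := Bim p (GenX₂ p)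
abbrev X₃ (p : ℕ) : Type := Bim p (GenX₃ p)

/-- The grading of the generators of `X₁`: `⋀ʲV` has degree `j`. -/
def grX₁ (p : ℕ) (d : ℤ) : Set (GenX₁ p) := {m | (d ≠ 0 → m.1 = 0) ∧ (d ≠ 1 → m.2 = 0)}

/-- The grading of the generators of `X₂`: `⋀ʲV` has degree `j`. -/
def grX₂ (p : ℕ) (d : ℤ) : Set (GenX₂ p) :=
  {m | (d ≠ 0 → m.1 = 0) ∧ (d ≠ 1 → m.2.1 = 0) ∧ (d ≠ 2 → m.2.2 = 0)}

/-- The inclusion of `V` in the generators of `X₂`. -/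
def inV (p : ℕ) : V p →ₗ[ZMod p] GenX₂ p := LinearMap.inr _ _ _ ∘ₗ LinearMap.inl _ _ _

/-- The inclusion of `⋀²V` in the generators of `X₂`. -/
def inW (p : ℕ) : ⋀[ZMod p]^2 (V p) →ₗ[ZMod p] GenX₂ p :=
  LinearMap.inr _ _ _ ∘ₗ LinearMap.inr _ _ _

/-- The differential `X₂ → X₁`. -/
def dX₂ (p : ℕ) : X₂ p →ₗ[Ae p] X₁ p :=
  bimLift (LinearMap.coprod
    (LinearMap.toSpanSingleton (ZMod p) _
      (∑ l ∈ Finset.range p, tri (ofG (g p ^ l)) ((1, 0) : GenX₁ p) (ofG (g p ^ (p - 1 - l)))))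
    (LinearMap.coprod
      (triL (ofG (g p)) 1 ∘ₗ LinearMap.inr _ _ _
        - triL 1 (ofG (g p)) ∘ₗ LinearMap.inr _ _ _ ∘ₗ act (g p)
        - koszul₁ (g p) ((1, 0) : GenX₁ p))
      (koszul₂ 1 (LinearMap.inr _ _ _))))

/-- The differential `X₃ → X₂`. -/
def dX₃ (p : ℕ) : X₃ p →ₗ[Ae p] X₂ p :=
  bimLift (LinearMap.coprod
    (LinearMap.toSpanSingleton (ZMod p) _
      (tri (ofG (g p)) ((1, 0, 0) : GenX₂ p) 1 - tri 1 ((1, 0, 0) : GenX₂ p) (ofG (g p))))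
    (LinearMap.coprod
      ((∑ l ∈ Finset.range p,
          triL (ofG (g p ^ (p - 1 - l))) (ofG (g p ^ l)) ∘ₗ inV p ∘ₗ act (g p ^ l))
        + koszul₁ 1 ((1, 0, 0) : GenX₂ p))
      (triL (ofG (g p)) 1 ∘ₗ inW p
        - triL 1 (ofG (g p)) ∘ₗ inW p ∘ₗ actW (g p)
        - koszul₂ (g p) (inV p))))

/-- `c` is a 2-cocycle of graded degree `-1` in the complex `Hom_{Aᵉ}(X, A)`. -/
def IsCocycleX {p : ℕ} (c : X₂ p →ₗ[Ae p] A p) : Prop :=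
  IsDegNegOne (grX₂ p) c ∧ c ∘ₗ dX₃ p = 0

/-- `c` is the coboundary of a 1-cochain of graded degree `-1` in `Hom_{Aᵉ}(X, A)`. Hence
`HH²₋₁(A)` is the space of cocycles as above modulo these coboundaries. -/
def IsCoboundaryX {p : ℕ} (c : X₂ p →ₗ[Ae p] A p) : Prop :=
  ∃ f : X₁ p →ₗ[Ae p] A p, IsDegNegOne (grX₁ p) f ∧ c = f ∘ₗ dX₂ p

/-! ### The reduced-bar-twisted-Koszul resolution `Y = B̄(G) ⊗ᴳ K` in degrees 2, 3

`Y_n` is the sum over `i + j = n` of `Y_{i,j} = A ⊗ Ḡ^{⊗i} ⊗ ⋀ʲV ⊗ A` with `Ḡ = 𝔽_pG / 𝔽_p·1`, with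
differential `d_B ⊗ 1 + (-1)ⁱ 1 ⊗ d_K`. The generator `1 ⊗ h₁ ⊗ ⋯ ⊗ h_i ⊗ 1` of `B̄(G)_i` has
group degree `h₁ ⋯ h_i`. -/

/-- The reduced group algebra `𝔽_pG / 𝔽_p·1`. -/
abbrev Gbar (p : ℕ) : Type :=
  MonoidAlgebra (ZMod p) (G p) ⧸ Submodule.span (ZMod p) {(1 : MonoidAlgebra (ZMod p) (G p))}

/-- The class of `h ∈ G` in `𝔽_pG / 𝔽_p·1`. -/
def br {p : ℕ} (h : G p) : Gbar p := Submodule.Quotient.mk (MonoidAlgebra.single h 1)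

lemma br_one {p : ℕ} : br (1 : G p) = 0 :=
  (Submodule.Quotient.mk_eq_zero _).2 (Submodule.subset_span rfl)

section bar

variable {p : ℕ} {M N : Type} [AddCommGroup M] [Module (ZMod p) M]
  [AddCommGroup N] [Module (ZMod p) N]

/-- The linear map on `𝔽_pG / 𝔽_p·1` with `h ↦ f h`, for `f` with `f 1 = 0`. -/
def barLift (f : G p → N) (hf : f 1 = 0) : Gbar p →ₗ[ZMod p] N :=
  Submodule.liftQ _
    (Finsupp.linearCombination (ZMod p) f ∘ₗ
      (MonoidAlgebra.coeffLinearEquiv (ZMod p)).toLinearMap)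
    (by
      rw [Submodule.span_singleton_le_iff_mem, LinearMap.mem_ker]
      simp [MonoidAlgebra.one_def, hf])

@[simp] lemma barLift_br (f : G p → N) (hf : f 1 = 0) (h : G p) : barLift f hf (br h) = f h := by
  simp [barLift, br]

lemma bar_ext {f f' : Gbar p →ₗ[ZMod p] N} (h : ∀ k, f (br k) = f' (br k)) : f = f' := by
  refine Submodule.linearMap_qext _ ?_
  ext k
  exact h k

/-- The linear map on `Ḡ ⊗ M` with `h ⊗ m ↦ φ h m`. -/
def barLift₁ (φ : G p → M →ₗ[ZMod p] N) (hφ : φ 1 = 0) : Gbar p ⊗[ZMod p] M →ₗ[ZMod p] N :=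
  TensorProduct.lift (barLift φ hφ)

/-- The linear map on `Ḡ ⊗ Ḡ ⊗ M` with `h ⊗ k ⊗ m ↦ φ h k m`. -/
def barLift₂ (φ : G p → G p → M →ₗ[ZMod p] N) (hl : ∀ k, φ 1 k = 0) (hr : ∀ h, φ h 1 = 0) :
    Gbar p ⊗[ZMod p] (Gbar p ⊗[ZMod p] M) →ₗ[ZMod p] N :=
  barLift₁ (fun h => barLift₁ (φ h) (hr h)) (by
    refine TensorProduct.ext (bar_ext fun k => ?_)
    ext m
    simp [barLift₁, hl])

end bar

/-- The generators of `Y₂ = Y_{2,0} ⊕ Y_{1,1} ⊕ Y_{0,2}`. -/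
abbrev GenY₂ (p : ℕ) : Type :=
  (Gbar p ⊗[ZMod p] Gbar p) × (Gbar p ⊗[ZMod p] V p) × ⋀[ZMod p]^2 (V p)

/-- The generators of `Y₃ = Y_{3,0} ⊕ Y_{2,1} ⊕ Y_{1,2}` (`Y_{0,3} = 0` as `⋀³V = 0`). -/
abbrev GenY₃ (p : ℕ) : Type :=
  (Gbar p ⊗[ZMod p] (Gbar p ⊗[ZMod p] Gbar p)) × (Gbar p ⊗[ZMod p] (Gbar p ⊗[ZMod p] V p)) ×
    (Gbar p ⊗[ZMod p] ⋀[ZMod p]^2 (V p))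

abbrev Y₂ (p : ℕ) : Type := Bim p (GenY₂ p)
abbrev Y₃ (p : ℕ) : Type := Bim p (GenY₃ p)

/-- The grading of the generators of `Y₂`: `Ḡ^{⊗i} ⊗ ⋀ʲV` has degree `j`. -/
def grY₂ (p : ℕ) (d : ℤ) : Set (GenY₂ p) :=
  {m | (d ≠ 0 → m.1 = 0) ∧ (d ≠ 1 → m.2.1 = 0) ∧ (d ≠ 2 → m.2.2 = 0)}

/-- The generator `h ⊗ k` of `Y_{2,0}`. -/
def genGG {p : ℕ} (h k : G p) : GenY₂ p := (br h ⊗ₜ br k, 0, 0)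

/-- The generators `h ⊗ v` of `Y_{1,1}`, as a linear map in `v`. -/
def genGV {p : ℕ} (h : G p) : V p →ₗ[ZMod p] GenY₂ p :=
  LinearMap.inr _ _ _ ∘ₗ LinearMap.inl _ _ _ ∘ₗ TensorProduct.mk (ZMod p) (Gbar p) (V p) (br h)

/-- The generators in `⋀²V` of `Y_{0,2}`. -/
def genW (p : ℕ) : ⋀[ZMod p]^2 (V p) →ₗ[ZMod p] GenY₂ p :=
  LinearMap.inr _ _ _ ∘ₗ LinearMap.inr _ _ _

lemma genGG_one_left {p : ℕ} (k : G p) : genGG 1 k = 0 := by simp [genGG, br_one]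

lemma genGG_one_right {p : ℕ} (k : G p) : genGG k 1 = 0 := by simp [genGG, br_one]

lemma genGV_one {p : ℕ} : genGV (1 : G p) = 0 := by
  ext <;> simp [genGV, br_one]

section

variable {p : ℕ} {M : Type} [AddCommGroup M] [Module (ZMod p) M]

lemma koszul₁_zero (h : G p) : koszul₁ h (0 : M) = 0 := by
  refine LinearMap.ext fun v => ?_
  simp [koszul₁, tri_zero]

lemma koszul₂_zero (h : G p) : koszul₂ h (0 : V p →ₗ[ZMod p] M) = 0 :=
  wedge_ext fun u w => by simp [koszul₂_wedge, tri_zero]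

end

/-- The differential on `Y_{3,0}`:
`h ⊗ k ⊗ l ↦ h (k ⊗ l) - hk ⊗ l + h ⊗ kl - (h ⊗ k) l`. -/
def dY₃₀ (p : ℕ) : Gbar p ⊗[ZMod p] (Gbar p ⊗[ZMod p] Gbar p) →ₗ[ZMod p] Y₂ p :=
  barLift₂
    (fun h k : G p => barLift
      (fun l => tri (ofG h) (genGG k l) 1 - tri 1 (genGG (h * k) l) 1
        + tri 1 (genGG h (k * l)) 1 - tri 1 (genGG h k) (ofG l))
      (by simp [genGG_one_right, tri_zero, ofG_one]))
    (fun k => bar_ext fun l => by simp [genGG_one_left, tri_zero, ofG_one])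
    (fun h => bar_ext fun l => by simp [genGG_one_left, genGG_one_right, tri_zero])

/-- The differential on `Y_{2,1}`:
`h ⊗ k ⊗ v ↦ h (k ⊗ v) - hk ⊗ v + (h ⊗ ᵏv) k + ʰᵏv (h ⊗ k) - (h ⊗ k) v`. -/
def dY₂₁ (p : ℕ) : Gbar p ⊗[ZMod p] (Gbar p ⊗[ZMod p] V p) →ₗ[ZMod p] Y₂ p :=
  barLift₂
    (fun h k : G p => triL (ofG h) 1 ∘ₗ genGV k - triL 1 1 ∘ₗ genGV (h * k)
        + triL 1 (ofG k) ∘ₗ genGV h ∘ₗ act k + koszul₁ (h * k) (genGG h k))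
    (fun k => by simp [genGG_one_left, genGV_one, koszul₁_zero, ofG_one])
    (fun h => by simp [genGG_one_right, genGV_one, koszul₁_zero, ofG_one, act_one])

/-- The differential on `Y_{1,2}`:
`h ⊗ u ∧ w ↦ h (u ∧ w) - (ʰu ∧ ʰw) h - (ʰu (h ⊗ w) - ʰw (h ⊗ u) + (h ⊗ u) w - (h ⊗ w) u)`. -/
def dY₁₂ (p : ℕ) : Gbar p ⊗[ZMod p] ⋀[ZMod p]^2 (V p) →ₗ[ZMod p] Y₂ p :=
  barLift₁
    (fun h : G p => triL (ofG h) 1 ∘ₗ genW p - triL 1 (ofG h) ∘ₗ genW p ∘ₗ actW h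
        - koszul₂ h (genGV h))
    (by simp [genGV_one, koszul₂_zero, ofG_one, actW, act_one])

/-- The differential `Y₃ → Y₂`. -/
def dY₃ (p : ℕ) : Y₃ p →ₗ[Ae p] Y₂ p :=
  bimLift (LinearMap.coprod (dY₃₀ p) (LinearMap.coprod (dY₂₁ p) (dY₁₂ p)))

/-- `c` is a 2-cocycle of graded degree `-1` in the complex `Hom_{Aᵉ}(Y, A)`. -/
def IsCocycleY {p : ℕ} (c : Y₂ p →ₗ[Ae p] A p) : Prop :=
  IsDegNegOne (grY₂ p) c ∧ c ∘ₗ dY₃ p = 0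

/-! ### The chain map `π₂ : Y₂ → X₂` -/

lemma transvection_pow (p n : ℕ) :
    ((transvection p ^ n : GL (Fin 2) (ZMod p)) : Matrix (Fin 2) (Fin 2) (ZMod p))
      = !![1, (n : ZMod p); 0, 1] := by
  induction n with
  | zero => ext i j; fin_cases i <;> fin_cases j <;> simp
  | succ n ih =>
    rw [pow_succ, Units.val_mul, ih]
    ext i j
    fin_cases i <;> fin_cases j <;> simp [transvection, Matrix.mul_apply, add_comm]

lemma g_pow_p (p : ℕ) : g p ^ p = 1 := by
  apply Subtype.ext
  apply Units.ext
  change ((transvection p ^ p : GL (Fin 2) (ZMod p)) : Matrix (Fin 2) (Fin 2) (ZMod p)) = 1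
  rw [transvection_pow]
  ext i j
  fin_cases i <;> fin_cases j <;> simp

lemma exists_pow {p : ℕ} [Fact p.Prime] (h : G p) : ∃ e < p, g p ^ e = h := by
  obtain ⟨h, hh⟩ := h
  obtain ⟨k, rfl⟩ := Subgroup.mem_zpowers_iff.1 hh
  have hp : (0 : ℤ) < p := by exact_mod_cast (Fact.out : p.Prime).pos
  have h0 := Int.emod_nonneg k hp.ne'
  have h1 := Int.emod_lt_of_pos k hp
  have hk : g p ^ k = g p ^ (k % p).toNat := by
    rw [← zpow_natCast, Int.toNat_of_nonneg h0]
    conv_lhs => rw [← Int.emod_add_mul_ediv k p, zpow_add, zpow_mul, zpow_natCast, g_pow_p]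
    simp
  exact ⟨(k % p).toNat, by omega, hk.symm⟩

open Classical in
/-- The exponent `e` with `0 ≤ e < p` and `gᵉ = h`. -/
def expo {p : ℕ} [Fact p.Prime] (h : G p) : ℕ := Nat.find (exists_pow h)

lemma expo_lt {p : ℕ} [Fact p.Prime] (h : G p) : expo h < p := by
  classical exact (Nat.find_spec (exists_pow h)).1

lemma g_pow_expo {p : ℕ} [Fact p.Prime] (h : G p) : g p ^ expo h = h := by
  classical exact (Nat.find_spec (exists_pow h)).2

lemma g_pow_inj {p : ℕ} {i j : ℕ} (hi : i < p) (hj : j < p) (h : g p ^ i = g p ^ j) : i = j := by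
  have h' := congrArg (fun x : G p => (x : GL (Fin 2) (ZMod p)).val 0 1) h
  have hc (n : ℕ) : ((g p ^ n : G p) : GL (Fin 2) (ZMod p)).val 0 1 = (n : ZMod p) := by
    change (transvection p ^ n : GL (Fin 2) (ZMod p)).val 0 1 = _
    rw [transvection_pow]; rfl
  simp only [hc] at h'
  rw [ZMod.natCast_eq_natCast_iff'] at h'
  rwa [Nat.mod_eq_of_lt hi, Nat.mod_eq_of_lt hj] at h'

lemma expo_g_pow {p : ℕ} [Fact p.Prime] {i : ℕ} (hi : i < p) : expo (g p ^ i) = i :=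
  g_pow_inj (expo_lt _) hi (g_pow_expo _)

lemma expo_one {p : ℕ} [Fact p.Prime] : expo (1 : G p) = 0 := by
  simpa using expo_g_pow (i := 0) (Fact.out : p.Prime).pos

section pi

variable (p : ℕ) [Fact p.Prime]

/-- `π₂` on `Y_{2,0}`: `gˢ ⊗ gʳ ↦ 1 ⊗ g^{s+r-p}` for `0 ≤ s, r < p`, where a negative power of `g`
is read as `0`. -/
def pi₂₀ : Gbar p ⊗[ZMod p] Gbar p →ₗ[ZMod p] X₂ p :=
  barLift₁
    (fun h => barLift
      (fun k => if p ≤ expo h + expo k then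
        tri 1 ((1, 0, 0) : GenX₂ p) (ofG (g p ^ (expo h + expo k - p))) else 0)
      (by simp [expo_one, expo_lt]))
    (bar_ext fun k => by simp [expo_one, expo_lt])

/-- `π₂` on `Y_{1,1}`: `gˢ ⊗ v ↦ ∑_{0 ≤ ℓ < s} g^{s-1-ℓ} ⊗ (g^ℓ v) ⊗ g^ℓ` for `0 ≤ s < p`. -/
def pi₁₁ : Gbar p ⊗[ZMod p] V p →ₗ[ZMod p] X₂ p :=
  barLift₁
    (fun h => ∑ l ∈ Finset.range (expo h),
      triL (ofG (g p ^ (expo h - 1 - l))) (ofG (g p ^ l)) ∘ₗ inV p ∘ₗ act (g p ^ l))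
    (by simp [expo_one])

/-- The chain map `π₂ : Y₂ → X₂`; it is `u ∧ w ↦ u ∧ w` on `Y_{0,2}`. -/
def pi₂ : Y₂ p →ₗ[Ae p] X₂ p :=
  bimLift (LinearMap.coprod (pi₂₀ p) (LinearMap.coprod (pi₁₁ p) (triL 1 1 ∘ₗ inW p)))

end pi

/-! ### The distinguished cocycles on `X` -/

section gamma

variable {p : ℕ} [Fact p.Prime]

/-- The distinguished 2-cochain on `X` with parameters `a₀, …, a_{p-1}` and `b₀, …, b_{p-1}`: it is
zero on `X_{2,0}`, and
`v₁ ↦ ∑_{0 ≤ ℓ < p} b_ℓ g^{ℓ+1}`, `v₂ ↦ ∑_{1 ≤ ℓ < p} a_ℓ g^{ℓ+1}`,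
`v₁ ∧ v₂ ↦ a₀ v₁ + ∑_{0 ≤ ℓ < p} ℓ b_ℓ v₂ g^ℓ`. -/
def gammaX (a b : Fin p → ZMod p) : X₂ p →ₗ[Ae p] A p :=
  bimLift (LinearMap.coprod 0 (LinearMap.coprod
    (LinearMap.coprod
      (LinearMap.toSpanSingleton (ZMod p) (A p) (∑ l : Fin p, b l • ofG (g p ^ (l.val + 1))))
      (LinearMap.toSpanSingleton (ZMod p) (A p)
        (∑ l ∈ Finset.univ.filter (fun l : Fin p => l ≠ 0), a l • ofG (g p ^ (l.val + 1))))
      ∘ₗ (LinearMap.proj 0).prod (LinearMap.proj 1))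
    (wedgeLift ((LinearMap.mul (ZMod p) (ZMod p)).compl₁₂ (LinearMap.proj 0) (LinearMap.proj 1)
      |>.compr₂ (LinearMap.toSpanSingleton (ZMod p) (A p)
        (a 0 • ofV p (v₁ p)
          + ∑ l : Fin p, ((l.val : ZMod p) * b l) • (ofV p (v₂ p) * ofG (g p ^ l.val))))))))

end gamma

end TransvectionHH

end

open TransvectionHH

/-!
A bimodule map `f` on `X₂` of degree `-1` vanishes on `X_{2,0}`, as `A` has nothing in degree `-1`,
and is given by its values at `v₁`, `v₂`, which lie in the group algebra `𝔽_pG`, and at `v₁ ∧ v₂`,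
which lies in `v₁ 𝔽_pG ⊕ v₂ 𝔽_pG`. Write these values as `β g`, `α g` and `v₁ ξ + v₂ η`. In `A` the
vector `v₁` commutes with `𝔽_pG`, and `β v₂ = v₂ β + v₁ β'`, where `'` is the derivation `gˡ ↦ l gˡ`
of `𝔽_pG` (`euler` on coefficients). With these rules everything is a computation in coordinates.

* The cocycle condition on `X_{2,1}` involves only the multiples `p` and `p(p-1)/2` of `β` and `α`,
  so it is empty for odd `p`. The condition on `X_{1,2}` says `η = β'` (`koszul_defect`,
  `isCocycleX_iff`).
* The coboundary of a 1-cochain with value `y ∈ 𝔽_pG` at `v₁` adds `-y g` at `v₂` and `v₁ y'` at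
  `v₁ ∧ v₂`, and nothing else (`isCoboundaryX_iff`). As `y'` has zero coefficient at `1` and otherwise
  determines the coefficients of `y`, exactly one coboundary turns `ξ` into a scalar and removes the
  coefficient of `g` from the value at `v₂`. What remains is a distinguished cocycle
  (`existsUnique_gammaX`).
* On `Y` the transferred cochain has value `n β gⁿ` at `gⁿ ⊗ v₁` and `(n choose 2) β gⁿ + n α gⁿ` at
  `gⁿ ⊗ v₂`. Since `p` is odd, `n choose 2` depends only on `n` modulo `p`, so these formulas hold for
  all `n`, and the cocycle condition on `Y_{2,1}` becomes Vandermonde's identity for `n choose 2`.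
  The condition on `Y_{1,2}` is again `koszul_defect`, now for `gⁿ` (`isCocycleY_transfer`).
-/

noncomputable section

namespace TransvectionHH

/-! ### Homogeneous elements of the skew group algebra -/

section homogeneous

variable {p : ℕ}

/-- The `S(V)`-coefficient of `x ∈ A` at the group element `h`. -/
def coef (h : G p) : A p →ₗ[ZMod p] S p where
  toFun x := SkewMonoidAlgebra.coeff x h
  map_add' x y := DFunLike.congr_fun
    (SkewMonoidAlgebra.coeff_add (x : SkewMonoidAlgebra (S p) (G p)) y) h
  map_smul' c x := DFunLike.congr_fun
    (SkewMonoidAlgebra.coeff_smul c (x : SkewMonoidAlgebra (S p) (G p))) h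

lemma coef_ext {x y : A p} (h : ∀ k, coef k x = coef k y) : x = y :=
  SkewMonoidAlgebra.ext h

/-- The element `s h` of `A`, for `s ∈ S(V)` and `h ∈ G`. -/
def mono (h : G p) (s : S p) : A p := (SkewMonoidAlgebra.single h s : SkewMonoidAlgebra (S p) (G p))

lemma mono_mul_mono (h k : G p) (s t : S p) :
    mono h s * mono k t = mono (h * k) (s * actS h t) :=
  SkewMonoidAlgebra.single_mul_single

lemma coef_mono_self (h : G p) (s : S p) : coef h (mono h s) = s := by
  classical
  exact (SkewMonoidAlgebra.coeff_single_apply (a := h) (a' := h)).trans (if_pos rfl)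

lemma coef_mono_of_ne {h k : G p} (hk : h ≠ k) (s : S p) : coef k (mono h s) = 0 := by
  classical
  exact (SkewMonoidAlgebra.coeff_single_apply (a := h) (a' := k)).trans (if_neg hk)

lemma ofV_mul_ofG (v : V p) (h : G p) : ofV p v * ofG h = mono h (toS p v) := by
  change mono 1 (toS p v) * mono h 1 = _
  rw [mono_mul_mono, one_mul, map_one, mul_one]

/-- The homogeneous polynomials of degree `d` in `S(V)`. The degree is an integer, and for `d < 0`
only the zero polynomial is homogeneous of degree `d`. -/
def homogS (p : ℕ) (d : ℤ) : Submodule (ZMod p) (S p) where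
  carrier := {f | ∀ m ∈ f.support, (m.degree : ℤ) = d}
  zero_mem' := by simp
  add_mem' {f f'} hf hf' m hm := by
    classical
    rcases Finset.mem_union.1 (MvPolynomial.support_add hm) with h | h
    exacts [hf m h, hf' m h]
  smul_mem' c f hf m hm := hf m (MvPolynomial.support_smul hm)

lemma mem_homogS_natCast {n : ℕ} {f : S p} : f ∈ homogS p n ↔ f.IsHomogeneous n := by
  constructor
  · intro h m hm
    have := h m (MvPolynomial.mem_support_iff.2 hm)
    rw [Finsupp.degree_eq_weight_one] at this
    exact_mod_cast this
  · intro h m hm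
    have := h (MvPolynomial.mem_support_iff.1 hm)
    rw [Finsupp.degree_eq_weight_one]
    exact_mod_cast this

lemma eq_zero_of_mem_homogS {d : ℤ} (hd : d < 0) {f : S p} (hf : f ∈ homogS p d) : f = 0 := by
  rw [← MvPolynomial.support_eq_empty, Finset.eq_empty_iff_forall_notMem]
  intro m hm
  have := hf m hm
  omega

lemma mul_mem_homogS {d e : ℤ} {f f' : S p} (hf : f ∈ homogS p d) (hf' : f' ∈ homogS p e) :
    f * f' ∈ homogS p (d + e) := by
  rcases lt_or_ge d 0 with hd | hd
  · rw [eq_zero_of_mem_homogS hd hf, zero_mul]; exact zero_mem _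
  rcases lt_or_ge e 0 with he | he
  · rw [eq_zero_of_mem_homogS he hf', mul_zero]; exact zero_mem _
  lift d to ℕ using hd
  lift e to ℕ using he
  rw [mem_homogS_natCast] at hf hf'
  exact_mod_cast mem_homogS_natCast.2 (hf.mul hf')

lemma isHomogeneous_toS (v : V p) : (toS p v).IsHomogeneous 1 := by
  rw [toS, Fintype.linearCombination_apply]
  refine MvPolynomial.IsHomogeneous.sum _ _ _ fun i _ => ?_
  rw [MvPolynomial.smul_eq_C_mul]
  exact (MvPolynomial.isHomogeneous_X _ i).C_mul _

lemma actS_mem_homogS (h : G p) {d : ℤ} {f : S p} (hf : f ∈ homogS p d) :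
    actS h f ∈ homogS p d := by
  rcases lt_or_ge d 0 with hd | hd
  · rw [eq_zero_of_mem_homogS hd hf, map_zero]; exact zero_mem _
  lift d to ℕ using hd
  rw [mem_homogS_natCast] at hf ⊢
  have := hf.aeval (fun j => toS p (act h (Pi.single j 1))) fun i => isHomogeneous_toS _
  rwa [one_mul] at this

/-- The homogeneous elements of degree `d` in `A`; membership unfolds to `IsHomogA d`. -/
def homogA (p : ℕ) (d : ℤ) : Submodule (ZMod p) (A p) where
  carrier := {x | ∀ h, coef h x ∈ homogS p d}
  zero_mem' h := by rw [map_zero]; exact zero_mem _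
  add_mem' hx hy h := by rw [map_add]; exact add_mem (hx h) (hy h)
  smul_mem' c _ hx h := by rw [map_smul]; exact Submodule.smul_mem _ c (hx h)

lemma mono_mem_homogA (h : G p) {d : ℤ} {s : S p} (hs : s ∈ homogS p d) :
    mono h s ∈ homogA p d := by
  intro k
  by_cases hk : h = k
  · subst hk; rwa [coef_mono_self]
  · rw [coef_mono_of_ne hk]; exact zero_mem _

lemma mul_mem_homogA {d e : ℤ} {x y : A p} (hx : x ∈ homogA p d) (hy : y ∈ homogA p e) :
    x * y ∈ homogA p (d + e) := by
  have : x * y = ∑ h ∈ (SkewMonoidAlgebra.coeff x).support,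
      ∑ k ∈ (SkewMonoidAlgebra.coeff y).support, mono (h * k) (coef h x * actS h (coef k y)) :=
    SkewMonoidAlgebra.mul_def
  rw [this]
  exact sum_mem fun h _ => sum_mem fun k _ =>
    mono_mem_homogA _ (mul_mem_homogS (hx h) (actS_mem_homogS h (hy k)))

lemma eq_zero_of_mem_homogA {d : ℤ} (hd : d < 0) {x : A p} (hx : x ∈ homogA p d) : x = 0 :=
  coef_ext fun h => by rw [eq_zero_of_mem_homogS hd (hx h), map_zero]

lemma ofG_mem_homogA (h : G p) : ofG h ∈ homogA p 0 :=
  mono_mem_homogA h (mem_homogS_natCast.2 (MvPolynomial.isHomogeneous_one _ _))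

lemma one_mem_homogA : (1 : A p) ∈ homogA p 0 := ofG_mem_homogA 1

lemma ofV_mem_homogA (v : V p) : ofV p v ∈ homogA p 1 :=
  mono_mem_homogA 1 (mem_homogS_natCast.2 (isHomogeneous_toS v))

end homogeneous

/-! ### The group algebra of `G` inside `A` and its commutation with `V` -/

section groupAlgebra

variable {p : ℕ}

/-- The element `∑ₗ xₗ gˡ` of the group algebra `𝔽_pG ⊆ A`. -/
def grp (p : ℕ) : (Fin p → ZMod p) →ₗ[ZMod p] A p :=
  Fintype.linearCombination (ZMod p) fun l : Fin p => ofG (g p ^ l.val)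

lemma grp_apply (x : Fin p → ZMod p) : grp p x = ∑ l, x l • ofG (g p ^ l.val) :=
  Fintype.linearCombination_apply _ _ _

/-- The derivation `gˡ ↦ l gˡ` of the group algebra, on coefficient vectors. -/
def euler (x : Fin p → ZMod p) : Fin p → ZMod p := fun l => (l.val : ZMod p) * x l

lemma act_g_pow_v₁ (n : ℕ) : act (g p ^ n) (v₁ p) = v₁ p := by
  change Matrix.mulVecLin ((transvection p ^ n : GL (Fin 2) (ZMod p)).val) _ = _
  rw [transvection_pow]
  ext i; fin_cases i <;> simp [v₁]

lemma act_g_pow_v₂ (n : ℕ) : act (g p ^ n) (v₂ p) = v₂ p + (n : ZMod p) • v₁ p := by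
  change Matrix.mulVecLin ((transvection p ^ n : GL (Fin 2) (ZMod p)).val) _ = _
  rw [transvection_pow]
  ext i; fin_cases i <;> simp [v₁, v₂]

lemma act_g_v₁ : act (g p) (v₁ p) = v₁ p := by simpa using act_g_pow_v₁ (p := p) 1

lemma act_g_v₂ : act (g p) (v₂ p) = v₂ p + v₁ p := by simpa using act_g_pow_v₂ (p := p) 1

lemma ofG_mul_v₁ (n : ℕ) : ofG (g p ^ n) * ofV p (v₁ p) = ofV p (v₁ p) * ofG (g p ^ n) := by
  rw [ofG_mul_ofV, act_g_pow_v₁]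

lemma ofG_mul_v₂ (n : ℕ) : ofG (g p ^ n) * ofV p (v₂ p)
    = ofV p (v₂ p) * ofG (g p ^ n) + (n : ZMod p) • (ofV p (v₁ p) * ofG (g p ^ n)) := by
  rw [ofG_mul_ofV, act_g_pow_v₂, map_add, map_smul, add_mul, smul_mul_assoc]

lemma ofG_comm_grp (n : ℕ) (x : Fin p → ZMod p) :
    ofG (g p ^ n) * grp p x = grp p x * ofG (g p ^ n) := by
  simp only [grp_apply, Finset.mul_sum, Finset.sum_mul, mul_smul_comm, smul_mul_assoc, ← ofG_mul,
    ← pow_add, add_comm]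

lemma grp_mul_v₁ (x : Fin p → ZMod p) :
    grp p x * ofV p (v₁ p) = ofV p (v₁ p) * grp p x := by
  simp only [grp_apply, Finset.mul_sum, Finset.sum_mul, mul_smul_comm, smul_mul_assoc, ofG_mul_v₁]

lemma grp_mul_v₂ (x : Fin p → ZMod p) :
    grp p x * ofV p (v₂ p) = ofV p (v₂ p) * grp p x + ofV p (v₁ p) * grp p (euler x) := by
  simp only [grp_apply, Finset.mul_sum, Finset.sum_mul, mul_smul_comm, smul_mul_assoc, ofG_mul_v₂,
    smul_add, Finset.sum_add_distrib, smul_smul, euler, mul_comm]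

lemma grp_single [NeZero p] (c : ZMod p) : grp p (Pi.single 0 c) = c • 1 := by
  rw [grp, Fintype.linearCombination_apply_single, Fin.val_zero, pow_zero, ofG_one]

lemma grp_mem_homogA (x : Fin p → ZMod p) : grp p x ∈ homogA p 0 := by
  rw [grp_apply]
  exact sum_mem fun l _ => Submodule.smul_mem _ _ (ofG_mem_homogA _)

lemma v_mul_grp_mem_homogA (v : V p) (x : Fin p → ZMod p) : ofV p v * grp p x ∈ homogA p 1 :=
  mul_mem_homogA (ofV_mem_homogA v) (grp_mem_homogA x)

lemma mul_ofG_cancel {h : G p} {x y : A p} (hxy : x * ofG h = y * ofG h) : x = y := by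
  have := congrArg (· * ofG h⁻¹) hxy
  simpa only [mul_assoc, ← ofG_mul, mul_inv_cancel, ofG_one, mul_one] using this

lemma toS_v₁ : toS p (v₁ p) = MvPolynomial.X 0 := by
  rw [← toS_single]; congr 1; ext i; fin_cases i <;> simp [v₁]

variable [Fact p.Prime]

lemma exists_fin_pow (h : G p) : ∃ l : Fin p, g p ^ l.val = h :=
  ⟨⟨expo h, expo_lt h⟩, g_pow_expo h⟩

lemma coef_v_mul_grp (v : V p) (x : Fin p → ZMod p) (l : Fin p) :
    coef (g p ^ l.val) (ofV p v * grp p x) = x l • toS p v := by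
  rw [grp_apply, Finset.mul_sum, map_sum, Finset.sum_eq_single l]
  · rw [mul_smul_comm, map_smul, ofV_mul_ofG, coef_mono_self]
  · intro k _ hk
    rw [mul_smul_comm, map_smul, ofV_mul_ofG, coef_mono_of_ne, smul_zero]
    exact fun h => hk (Fin.ext (g_pow_inj k.2 l.2 h))
  · simp

lemma coef_grp (x : Fin p → ZMod p) (l : Fin p) :
    coef (g p ^ l.val) (grp p x) = MvPolynomial.C (x l) := by
  rw [grp_apply, map_sum, Finset.sum_eq_single l]
  · rw [map_smul, ofG, ← mono, coef_mono_self, MvPolynomial.smul_eq_C_mul, mul_one]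
  · intro k _ hk
    rw [map_smul, ofG, ← mono, coef_mono_of_ne, smul_zero]
    exact fun h => hk (Fin.ext (g_pow_inj k.2 l.2 h))
  · simp

lemma grp_injective : Function.Injective (grp p) := fun x y h => by
  ext l
  have := congrArg (coef (g p ^ l.val)) h
  rw [coef_grp, coef_grp] at this
  exact MvPolynomial.C_injective _ _ this

lemma v₁_mul_grp_injective : Function.Injective fun x => ofV p (v₁ p) * grp p x := fun x y h => by
  ext l
  have := congrArg (coef (g p ^ l.val)) h
  simp only [coef_v_mul_grp, toS_v₁] at this
  exact smul_left_injective _ (MvPolynomial.X_ne_zero (0 : Fin 2)) this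

/-- `A` has degree zero part `𝔽_pG`. -/
lemma exists_eq_grp {z : A p} (hz : z ∈ homogA p 0) : ∃ x, z = grp p x := by
  refine ⟨fun l => MvPolynomial.coeff 0 (coef (g p ^ l.val) z), coef_ext fun h => ?_⟩
  obtain ⟨l, rfl⟩ := exists_fin_pow h
  rw [coef_grp]
  have h0 : (coef (g p ^ l.val) z).IsHomogeneous 0 := mem_homogS_natCast.1 (hz _)
  rw [← MvPolynomial.totalDegree_zero_iff_isHomogeneous] at h0
  exact MvPolynomial.totalDegree_eq_zero_iff_eq_C.1 h0

/-- `A` has degree one part `v₁ 𝔽_pG ⊕ v₂ 𝔽_pG`. -/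
lemma exists_eq_v_mul_grp {z : A p} (hz : z ∈ homogA p 1) :
    ∃ x y, z = ofV p (v₁ p) * grp p x + ofV p (v₂ p) * grp p y := by
  have hl (l : Fin p) : ∃ v : V p, coef (g p ^ l.val) z = toS p v := by
    have h1 : (coef (g p ^ l.val) z).IsHomogeneous 1 := mem_homogS_natCast.1 (hz _)
    rw [← MvPolynomial.mem_homogeneousSubmodule,
      MvPolynomial.homogeneousSubmodule_one_eq_span_X,
      ← Fintype.range_linearCombination] at h1
    exact h1.imp fun _ h => h.symm
  choose v hv using hl
  refine ⟨fun l => v l 0, fun l => v l 1, coef_ext fun h => ?_⟩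
  obtain ⟨l, rfl⟩ := exists_fin_pow h
  rw [map_add, coef_v_mul_grp, coef_v_mul_grp, hv, ← map_smul, ← map_smul, ← map_add]
  congr 1
  ext i; fin_cases i <;> simp [v₁, v₂]

end groupAlgebra

/-! ### Bimodule maps out of free bimodules -/

section bimoduleMaps

variable {p : ℕ} {M N : Type} [AddCommGroup M] [Module (ZMod p) M]

lemma tri_eq_env_smul (a b : A p) (m : M) : tri a m b = env a b • tri 1 m 1 := by
  rw [smul_tri, mul_one, one_mul]

/-- A bimodule map on `A ⊗ M ⊗ A` is determined by its values at the elements `1 ⊗ m ⊗ 1`. -/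
lemma bim_ext [AddCommGroup N] [Module (Ae p) N] {f f' : Bim p M →ₗ[Ae p] N}
    (h : ∀ m, f (tri 1 m 1) = f' (tri 1 m 1)) : f = f' := by
  have key (a b : A p) (m : M) : f (tri a m b) = f' (tri a m b) := by
    rw [tri_eq_env_smul, map_smul, map_smul, h]
  refine LinearMap.ext fun x => ?_
  change Ae p ⊗[ZMod p] M at x
  induction x using TensorProduct.induction_on with
  | zero => exact (map_zero f).trans (map_zero f').symm
  | add x y hx hy => exact (map_add f x y).trans ((congrArg₂ _ hx hy).trans (map_add f' x y).symm)
  | tmul e m =>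
    change A p ⊗[ZMod p] (A p)ᵐᵒᵖ at e
    induction e using TensorProduct.induction_on with
    | zero =>
      rw [show ((0 : A p ⊗[ZMod p] (A p)ᵐᵒᵖ) ⊗ₜ[ZMod p] m : Ae p ⊗[ZMod p] M) = 0 from
        TensorProduct.zero_tmul _ _]
      exact (map_zero f).trans (map_zero f').symm
    | add x y hx hy =>
      rw [show ((x + y : A p ⊗[ZMod p] (A p)ᵐᵒᵖ) ⊗ₜ[ZMod p] m : Ae p ⊗[ZMod p] M)
        = ((show Ae p from x) ⊗ₜ[ZMod p] m : Ae p ⊗[ZMod p] M) + (show Ae p from y) ⊗ₜ[ZMod p] m from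
        TensorProduct.add_tmul _ _ _]
      exact (map_add f _ _).trans ((congrArg₂ _ hx hy).trans (map_add f' _ _).symm)
    | tmul a b => exact key a b.unop m

lemma map_tri (f : Bim p M →ₗ[Ae p] A p) (a b : A p) (m : M) :
    f (tri a m b) = a * f (tri 1 m 1) * b := by
  rw [tri_eq_env_smul, map_smul, env_smul]

lemma map_zmod_smul (f : Bim p M →ₗ[Ae p] A p) (c : ZMod p) (x : Bim p M) :
    f (c • x) = c • f x := by
  rw [← algebraMap_smul (Ae p) c x, map_smul, algebraMap_smul]

/-- The linear map `m ↦ f (1 ⊗ m ⊗ 1)` of generators that determines a bimodule map `f`. -/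
def onGen (f : Bim p M →ₗ[Ae p] A p) : M →ₗ[ZMod p] A p where
  toFun m := f (tri 1 m 1)
  map_add' m m' := by rw [tri_add_mid, map_add]
  map_smul' c m := by rw [tri_smul_mid, map_zmod_smul, RingHom.id_apply]

lemma onGen_apply (f : Bim p M →ₗ[Ae p] A p) (m : M) : onGen f m = f (tri 1 m 1) := rfl

lemma map_triL (f : Bim p M →ₗ[Ae p] A p) (a b : A p) (m : M) :
    f (triL a b m) = a * onGen f m * b := map_tri f a b m

lemma onGen_injective : Function.Injective (onGen : (Bim p M →ₗ[Ae p] A p) → M →ₗ[ZMod p] A p) :=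
  fun _ _ h => bim_ext fun m => LinearMap.congr_fun h m

lemma bimLift_gen [AddCommMonoid N] [Module (ZMod p) N] [Module (Ae p) N]
    [IsScalarTower (ZMod p) (Ae p) N] [SMulCommClass (ZMod p) (Ae p) N]
    [SMulCommClass (Ae p) (ZMod p) N] (φ : M →ₗ[ZMod p] N) (m : M) :
    bimLift φ (tri 1 m 1) = φ m := by
  rw [bimLift_tri, show (env 1 1 : Ae p) = 1 from rfl, one_smul]

lemma onGen_bimLift (φ : M →ₗ[ZMod p] A p) : onGen (bimLift φ) = φ :=
  LinearMap.ext fun m => bimLift_gen φ m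

/-- The degree of a bimodule map can be read off its values on generators. -/
lemma isDegNegOne_iff (gr : ℤ → Set M) (f : Bim p M →ₗ[Ae p] A p) :
    IsDegNegOne gr f ↔ ∀ d, ∀ m ∈ gr d, onGen f m ∈ homogA p (d - 1) := by
  constructor
  · intro h d m hm
    exact h d _ (Submodule.subset_span
      ⟨0, d, 0, 1, m, 1, one_mem_homogA, hm, one_mem_homogA, by ring, rfl⟩)
  · intro h d x hx
    induction hx using Submodule.span_induction with
    | zero => rw [map_zero]; exact (homogA p (d - 1)).zero_mem
    | add x y _ _ hx hy => rw [map_add]; exact (homogA p (d - 1)).add_mem hx hy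
    | smul c x _ hx => rw [map_zmod_smul]; exact (homogA p (d - 1)).smul_mem c hx
    | mem x hx =>
      obtain ⟨r, j, s, a, m, b, ha, hm, hb, hd, rfl⟩ := hx
      rw [map_tri, show d - 1 = r + (j - 1) + s by omega]
      exact mul_mem_homogA (mul_mem_homogA ha (h j m hm)) hb

lemma map_tri_one_right (f : Bim p M →ₗ[Ae p] A p) (a : A p) (m : M) :
    f (tri a m 1) = a * onGen f m := by
  rw [map_tri, mul_one, onGen_apply]

lemma map_tri_one_left (f : Bim p M →ₗ[Ae p] A p) (b : A p) (m : M) :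
    f (tri 1 m b) = onGen f m * b := by
  rw [map_tri, one_mul, onGen_apply]

lemma map_koszul₁ (f : Bim p M →ₗ[Ae p] A p) (h : G p) (m : M) (v : V p) :
    f (koszul₁ h m v) = ofV p (act h v) * onGen f m - onGen f m * ofV p v := by
  change f (tri (ofV p (act h v)) m 1 - tri 1 m (ofV p v)) = _
  rw [map_sub, map_tri_one_right, map_tri_one_left]

lemma map_koszul₂ (f : Bim p M →ₗ[Ae p] A p) (h : G p) (j : V p →ₗ[ZMod p] M) (u w : V p) :
    f (koszul₂ h j (wedge u w)) = ofV p (act h u) * onGen f (j w) + onGen f (j u) * ofV p w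
      - (ofV p (act h w) * onGen f (j u) + onGen f (j w) * ofV p u) := by
  rw [koszul₂_wedge, map_sub, map_add, map_add, map_tri_one_right, map_tri_one_right,
    map_tri_one_left, map_tri_one_left]

end bimoduleMaps

section linearMaps

variable {p : ℕ} {N : Type} [AddCommGroup N] [Module (ZMod p) N]

lemma V_ext {f f' : V p →ₗ[ZMod p] N} (h₁ : f (v₁ p) = f' (v₁ p)) (h₂ : f (v₂ p) = f' (v₂ p)) :
    f = f' := by
  have e₁ : v₁ p = Pi.single 0 1 := by ext i; fin_cases i <;> rfl
  have e₂ : v₂ p = Pi.single 1 1 := by ext i; fin_cases i <;> rfl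
  rw [e₁] at h₁
  rw [e₂] at h₂
  refine LinearMap.pi_ext' fun j => LinearMap.ext_ring ?_
  fin_cases j
  exacts [h₁, h₂]

lemma wedge_swap (u w : V p) : wedge w u = -wedge u w := by
  have := (exteriorPower.ιMulti (ZMod p) 2).map_swap ![u, w] (zero_ne_one : (0 : Fin 2) ≠ 1)
  rw [wedge, wedge, ← this]
  congr 1
  ext i : 1
  fin_cases i <;> simp

/-- `⋀²V` is spanned by `v₁ ∧ v₂`. -/
lemma W_ext {f f' : ⋀[ZMod p]^2 (V p) →ₗ[ZMod p] N}
    (h : f (wedge (v₁ p) (v₂ p)) = f' (wedge (v₁ p) (v₂ p))) : f = f' := by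
  refine exteriorPower.linearMap_ext
    (Module.Basis.ext_alternating (Pi.basisFun (ZMod p) (Fin 2)) fun s hs => ?_)
  have e₁ : v₁ p = Pi.single 0 1 := by ext i; fin_cases i <;> rfl
  have e₂ : v₂ p = Pi.single 1 1 := by ext i; fin_cases i <;> rfl
  have hw : (fun i => Pi.basisFun (ZMod p) (Fin 2) (s i))
      = ![Pi.single (s 0) 1, Pi.single (s 1) 1] := by
    ext i : 1
    fin_cases i <;> simp
  rw [hw]
  change f (wedge _ _) = f' (wedge _ _)
  have h01 : s 0 ≠ s 1 := fun h => zero_ne_one (hs h)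
  rw [e₁, e₂] at h
  rcases Fin.exists_fin_two.1 ⟨s 0, rfl⟩ with h0 | h0 <;>
    rcases Fin.exists_fin_two.1 ⟨s 1, rfl⟩ with h1 | h1 <;> rw [h0, h1] at h01 ⊢
  · exact absurd rfl h01
  · exact h
  · rw [wedge_swap, map_neg, map_neg, h]
  · exact absurd rfl h01

lemma wedge_self (u : V p) : wedge u u = 0 :=
  (exteriorPower.ιMulti (ZMod p) 2).map_eq_zero_of_eq ![u, u] (i := 0) (j := 1) rfl zero_ne_one

/-- The transvection has determinant one, so `G` acts trivially on `⋀²V`. -/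
lemma actW_g_pow (n : ℕ) : actW (g p ^ n) (wedge (v₁ p) (v₂ p)) = wedge (v₁ p) (v₂ p) := by
  have h : actW (g p ^ n) (wedge (v₁ p) (v₂ p))
      = wedge (act (g p ^ n) (v₁ p)) (act (g p ^ n) (v₂ p)) := by
    rw [actW, wedge, exteriorPower.map_apply_ιMulti, wedge]
    congr 1
    ext i : 1
    fin_cases i <;> rfl
  have e : wedge (v₁ p) (v₂ p + (n : ZMod p) • v₁ p)
      = wedge (v₁ p) (v₂ p) + (n : ZMod p) • wedge (v₁ p) (v₁ p) := by
    have ha := (exteriorPower.ιMulti (ZMod p) 2).map_update_add ![v₁ p, 0] 1 (v₂ p)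
      ((n : ZMod p) • v₁ p)
    have hs := (exteriorPower.ιMulti (ZMod p) 2).map_update_smul ![v₁ p, 0] 1 (n : ZMod p) (v₁ p)
    rw [hs] at ha
    have hu (x : V p) : Function.update ![v₁ p, 0] 1 x = ![v₁ p, x] := by
      ext i : 1; fin_cases i <;> simp
    simp only [hu] at ha
    exact ha
  rw [h, act_g_pow_v₁, act_g_pow_v₂, e, wedge_self, smul_zero, add_zero]

end linearMaps

/-! ### Cocycles and coboundaries on the twisted product with the periodic resolution -/

section complexX

variable {p : ℕ}

/-- The Koszul part of the cocycle condition at `gⁿ ⊗ (v₁ ∧ v₂)`. It is the only condition that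
restricts a cochain of degree `-1`: it compares the `v₂`-part of the value at `v₁ ∧ v₂` with the
derivative of the value at `v₁`. -/
lemma koszul_defect (n : ℕ) (b c x y : Fin p → ZMod p) :
    ofG (g p ^ n) * (ofV p (v₁ p) * grp p x + ofV p (v₂ p) * grp p y)
      - (ofV p (v₁ p) * grp p x + ofV p (v₂ p) * grp p y) * ofG (g p ^ n)
      - (ofV p (v₁ p) * (grp p c * ofG (g p ^ n))
          + (n : ZMod p) • (grp p b * ofG (g p ^ n)) * ofV p (v₂ p)
        - (ofV p (v₂ p + (n : ZMod p) • v₁ p) * ((n : ZMod p) • (grp p b * ofG (g p ^ n)))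
          + grp p c * ofG (g p ^ n) * ofV p (v₁ p)))
      = (n : ZMod p) • (ofV p (v₁ p) * grp p (y - euler b) * ofG (g p ^ n)) := by
  have h₁ : ofG (g p ^ n) * (ofV p (v₁ p) * grp p x) = ofV p (v₁ p) * grp p x * ofG (g p ^ n) := by
    rw [← mul_assoc, ofG_mul_v₁, mul_assoc, ofG_comm_grp, mul_assoc]
  have h₂ : ofG (g p ^ n) * (ofV p (v₂ p) * grp p y)
      = ofV p (v₂ p) * grp p y * ofG (g p ^ n)
        + (n : ZMod p) • (ofV p (v₁ p) * grp p y * ofG (g p ^ n)) := by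
    rw [← mul_assoc, ofG_mul_v₂, add_mul, smul_mul_assoc, mul_assoc, ofG_comm_grp, mul_assoc,
      mul_assoc, ofG_comm_grp, mul_assoc]
  have h₃ : grp p c * ofG (g p ^ n) * ofV p (v₁ p) = ofV p (v₁ p) * (grp p c * ofG (g p ^ n)) := by
    rw [mul_assoc, ofG_mul_v₁, ← mul_assoc, grp_mul_v₁, mul_assoc]
  have h₄ : grp p b * ofG (g p ^ n) * ofV p (v₂ p) = ofV p (v₂ p) * (grp p b * ofG (g p ^ n))
      + ofV p (v₁ p) * grp p (euler b) * ofG (g p ^ n)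
      + (n : ZMod p) • (ofV p (v₁ p) * (grp p b * ofG (g p ^ n))) := by
    rw [mul_assoc, ofG_mul_v₂, mul_add, mul_smul_comm, ← mul_assoc, ← mul_assoc, grp_mul_v₂,
      grp_mul_v₁, add_mul]
    simp only [mul_assoc]
  rw [mul_add, h₁, h₂, h₃, smul_mul_assoc, h₄, map_sub, map_add, map_smul]
  simp only [add_mul, mul_sub, sub_mul, smul_mul_assoc, mul_smul_comm, smul_add, smul_sub]
  abel

lemma genX₂_ext {f f' : X₂ p →ₗ[Ae p] A p} (h₀ : onGen f (1, 0, 0) = onGen f' (1, 0, 0))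
    (h₁ : onGen f (inV p (v₁ p)) = onGen f' (inV p (v₁ p)))
    (h₂ : onGen f (inV p (v₂ p)) = onGen f' (inV p (v₂ p)))
    (h₃ : onGen f (inW p (wedge (v₁ p) (v₂ p))) = onGen f' (inW p (wedge (v₁ p) (v₂ p)))) :
    f = f' := by
  refine onGen_injective (LinearMap.prod_ext (LinearMap.ext_ring h₀) (LinearMap.prod_ext ?_ ?_))
  · exact V_ext h₁ h₂
  · exact W_ext h₃

lemma onGen_sub {M : Type} [AddCommGroup M] [Module (ZMod p) M] (f f' : Bim p M →ₗ[Ae p] A p) :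
    onGen (f - f') = onGen f - onGen f' := rfl

lemma mem_grX₂_one : ((1, 0, 0) : GenX₂ p) ∈ grX₂ p 0 := by simp [grX₂]

lemma inV_mem_grX₂ (v : V p) : inV p v ∈ grX₂ p 1 := by simp [grX₂, inV]

lemma inW_mem_grX₂ (w : ⋀[ZMod p]^2 (V p)) : inW p w ∈ grX₂ p 2 := by simp [grX₂, inW]

/-- Degree `-1` on `X₂` means: zero on the unit generator, values in the group algebra on vectors,
and a value of degree one at `v₁ ∧ v₂`. -/
lemma isDegNegOne_X₂ (f : X₂ p →ₗ[Ae p] A p) :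
    IsDegNegOne (grX₂ p) f ↔ onGen f (1, 0, 0) = 0 ∧ onGen f (inV p (v₁ p)) ∈ homogA p 0 ∧
      onGen f (inV p (v₂ p)) ∈ homogA p 0 ∧
      onGen f (inW p (wedge (v₁ p) (v₂ p))) ∈ homogA p 1 := by
  rw [isDegNegOne_iff]
  constructor
  · intro h
    exact ⟨eq_zero_of_mem_homogA (by norm_num) (h 0 _ mem_grX₂_one),
      h 1 _ (inV_mem_grX₂ _), h 1 _ (inV_mem_grX₂ _), h 2 _ (inW_mem_grX₂ _)⟩
  · rintro ⟨h₀, h₁, h₂, h₃⟩ d ⟨r, v, w⟩ ⟨hr, hv, hw⟩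
    have e : onGen f (r, v, w)
        = onGen f (r, 0, 0) + onGen f (inV p v) + onGen f (inW p w) := by
      rw [← map_add, ← map_add]; simp [inV, inW]
    have hr0 : onGen f (r, 0, 0) = 0 := by
      rw [show ((r, 0, 0) : GenX₂ p) = r • ((1, 0, 0) : GenX₂ p) by simp, map_smul, h₀, smul_zero]
    have hV : onGen f (inV p v) ∈ homogA p 0 := by
      have : (homogA p 0).mkQ ∘ₗ onGen f ∘ₗ inV p = 0 :=
        V_ext (by simpa using h₁) (by simpa using h₂)
      simpa using LinearMap.congr_fun this v
    have hW : onGen f (inW p w) ∈ homogA p 1 := by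
      have : (homogA p 1).mkQ ∘ₗ onGen f ∘ₗ inW p = 0 := W_ext (by simpa using h₃)
      simpa using LinearMap.congr_fun this w
    rw [e, hr0, zero_add]
    refine add_mem ?_ ?_
    · by_cases hd : d = 1
      · subst hd; exact hV
      · rw [show v = 0 from hv hd, map_zero, map_zero]; exact zero_mem _
    · by_cases hd : d = 2
      · subst hd; exact hW
      · rw [show w = 0 from hw hd, map_zero, map_zero]; exact zero_mem _

lemma map_dX₃_wedge (f : X₂ p →ₗ[Ae p] A p) :
    f (dX₃ p (tri 1 (0, 0, wedge (v₁ p) (v₂ p)) 1))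
      = ofG (g p) * onGen f (inW p (wedge (v₁ p) (v₂ p)))
        - onGen f (inW p (wedge (v₁ p) (v₂ p))) * ofG (g p)
        - (ofV p (v₁ p) * onGen f (inV p (v₂ p)) + onGen f (inV p (v₁ p)) * ofV p (v₂ p)
          - (ofV p (v₂ p + v₁ p) * onGen f (inV p (v₁ p))
            + onGen f (inV p (v₂ p)) * ofV p (v₁ p))) := by
  have hW : actW (g p) (wedge (v₁ p) (v₂ p)) = wedge (v₁ p) (v₂ p) := by
    simpa using actW_g_pow (p := p) 1
  rw [dX₃, bimLift_gen]
  simp only [LinearMap.coprod_apply, map_zero, zero_add, LinearMap.sub_apply, LinearMap.comp_apply,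
    map_sub, map_triL, map_koszul₂, act_g_v₁, act_g_v₂, hW, one_mul, mul_one]

lemma map_dX₃_vector (f : X₂ p →ₗ[Ae p] A p) (h₀ : onGen f (1, 0, 0) = 0) (v : V p) :
    f (dX₃ p (tri 1 (0, v, 0) 1))
      = ∑ l ∈ Finset.range p, ofG (g p ^ (p - 1 - l)) * onGen f (inV p (act (g p ^ l) v))
          * ofG (g p ^ l) := by
  rw [dX₃, bimLift_gen]
  simp only [LinearMap.coprod_apply, map_zero, zero_add, add_zero, LinearMap.add_apply,
    LinearMap.sum_apply, LinearMap.comp_apply, map_add, map_sum, map_triL, map_koszul₁, h₀,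
    mul_zero, zero_mul, sub_zero]

lemma map_dX₃_one (f : X₂ p →ₗ[Ae p] A p) (h₀ : onGen f (1, 0, 0) = 0) :
    f (dX₃ p (tri 1 (1, 0, 0) 1)) = 0 := by
  rw [dX₃, bimLift_gen]
  simp only [LinearMap.coprod_apply, map_zero, add_zero, LinearMap.toSpanSingleton_apply, one_smul,
    map_sub, map_tri_one_left, map_tri_one_right, h₀, mul_zero, zero_mul, sub_zero]

/-- The translates `g^l v₂ = v₂ + l v₁` enter the sum `∑_{l < n} g^{n-1-l} c(g^l v) g^l` so that the
coefficients `l` of `v₁` add up to a binomial coefficient. -/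
lemma sum_conj_v₂ (f : V p →ₗ[ZMod p] A p) {b c : Fin p → ZMod p}
    (hb : f (v₁ p) = grp p b * ofG (g p)) (hc : f (v₂ p) = grp p c * ofG (g p)) (n : ℕ) :
    ∑ l ∈ Finset.range n, ofG (g p ^ (n - 1 - l)) * f (act (g p ^ l) (v₂ p)) * ofG (g p ^ l)
      = (n.choose 2 : ZMod p) • (grp p b * ofG (g p ^ n))
        + (n : ZMod p) • (grp p c * ofG (g p ^ n)) := by
  have key (l : ℕ) (hl : l ∈ Finset.range n) (x : Fin p → ZMod p) :
      ofG (g p ^ (n - 1 - l)) * (grp p x * ofG (g p)) * ofG (g p ^ l) = grp p x * ofG (g p ^ n) := by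
    rw [← mul_assoc, ofG_comm_grp, mul_assoc, mul_assoc, ← ofG_mul, ← ofG_mul, ← pow_succ',
      ← pow_add]
    congr 3
    have := Finset.mem_range.1 hl
    omega
  have : ∀ l ∈ Finset.range n,
      ofG (g p ^ (n - 1 - l)) * f (act (g p ^ l) (v₂ p)) * ofG (g p ^ l)
      = grp p c * ofG (g p ^ n) + (l : ZMod p) • (grp p b * ofG (g p ^ n)) := fun l hl => by
    rw [act_g_pow_v₂, map_add, map_smul, hb, hc, mul_add, add_mul, mul_smul_comm, smul_mul_assoc,
      key l hl, key l hl]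
  rw [Finset.sum_congr rfl this, Finset.sum_add_distrib, ← Finset.sum_smul, Finset.sum_const,
    Finset.card_range, ← Nat.cast_sum, Finset.sum_range_id, ← Nat.choose_two_right, add_comm,
    Nat.cast_smul_eq_nsmul (ZMod p) n]

lemma sum_conj_v₁ (f : V p →ₗ[ZMod p] A p) {b : Fin p → ZMod p}
    (hb : f (v₁ p) = grp p b * ofG (g p)) (n : ℕ) :
    ∑ l ∈ Finset.range n, ofG (g p ^ (n - 1 - l)) * f (act (g p ^ l) (v₁ p)) * ofG (g p ^ l)
      = (n : ZMod p) • (grp p b * ofG (g p ^ n)) := by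
  have : ∀ l ∈ Finset.range n,
      ofG (g p ^ (n - 1 - l)) * f (act (g p ^ l) (v₁ p)) * ofG (g p ^ l)
      = grp p b * ofG (g p ^ n) := fun l hl => by
    rw [act_g_pow_v₁, hb, ← mul_assoc, ofG_comm_grp, mul_assoc, mul_assoc, ← ofG_mul, ← ofG_mul,
      ← pow_succ', ← pow_add]
    congr 3
    have := Finset.mem_range.1 hl
    omega
  rw [Finset.sum_congr rfl this, Finset.sum_const, Finset.card_range, Nat.cast_smul_eq_nsmul]

variable [Fact p.Prime]

/-- The cocycles of degree `-1` on `X`, in coordinates. The condition on `X_{2,1}` is vacuous, since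
`p` and `p.choose 2` vanish modulo the odd prime `p`. -/
lemma isCocycleX_iff (hp : p ≠ 2) (f : X₂ p →ₗ[Ae p] A p) :
    IsCocycleX f ↔ ∃ b c x : Fin p → ZMod p, onGen f (1, 0, 0) = 0 ∧
      onGen f (inV p (v₁ p)) = grp p b * ofG (g p) ∧
      onGen f (inV p (v₂ p)) = grp p c * ofG (g p) ∧
      onGen f (inW p (wedge (v₁ p) (v₂ p)))
        = ofV p (v₁ p) * grp p x + ofV p (v₂ p) * grp p (euler b) := by
  have defect (b c x y : Fin p → ZMod p) (hb : onGen f (inV p (v₁ p)) = grp p b * ofG (g p))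
      (hc : onGen f (inV p (v₂ p)) = grp p c * ofG (g p))
      (hW : onGen f (inW p (wedge (v₁ p) (v₂ p)))
        = ofV p (v₁ p) * grp p x + ofV p (v₂ p) * grp p y) :
      f (dX₃ p (tri 1 (0, 0, wedge (v₁ p) (v₂ p)) 1))
        = ofV p (v₁ p) * grp p (y - euler b) * ofG (g p) := by
    have := koszul_defect 1 b c x y
    simp only [Nat.cast_one, one_smul, pow_one] at this
    rw [map_dX₃_wedge, hb, hc, hW, this]
  rw [IsCocycleX, isDegNegOne_X₂]
  constructor
  · rintro ⟨⟨h₀, h₁, h₂, h₃⟩, hd⟩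
    -- Every element of the group algebra is a multiple of `g`.
    have shift {z : A p} (hz : z ∈ homogA p 0) : ∃ x, z = grp p x * ofG (g p) := by
      obtain ⟨x, hx⟩ := exists_eq_grp (mul_mem_homogA hz (ofG_mem_homogA (g p)⁻¹))
      exact ⟨x, by rw [← hx, mul_assoc, ← ofG_mul, inv_mul_cancel, ofG_one, mul_one]⟩
    obtain ⟨b, hb⟩ := shift h₁
    obtain ⟨c, hc⟩ := shift h₂
    obtain ⟨x, y, hW⟩ := exists_eq_v_mul_grp h₃
    have hy := defect b c x y hb hc hW
    rw [← LinearMap.comp_apply, hd, LinearMap.zero_apply] at hy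
    have hy' : ofV p (v₁ p) * grp p (y - euler b) = ofV p (v₁ p) * grp p 0 := by
      refine mul_ofG_cancel (h := g p) ?_
      rw [← hy, map_zero, mul_zero, zero_mul]
    exact ⟨b, c, x, h₀, hb, hc, by rw [hW, sub_eq_zero.1 (v₁_mul_grp_injective hy')]⟩
  · rintro ⟨b, c, x, h₀, hb, hc, hW⟩
    refine ⟨⟨h₀, ?_, ?_, ?_⟩, onGen_injective (LinearMap.prod_ext (LinearMap.ext_ring ?_)
      (LinearMap.prod_ext (V_ext ?_ ?_) (W_ext ?_)))⟩
    · rw [hb]; exact mul_mem_homogA (grp_mem_homogA b) (ofG_mem_homogA _)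
    · rw [hc]; exact mul_mem_homogA (grp_mem_homogA c) (ofG_mem_homogA _)
    · rw [hW]; exact add_mem (v_mul_grp_mem_homogA _ _) (v_mul_grp_mem_homogA _ _)
    · exact map_dX₃_one f h₀
    · refine (map_dX₃_vector f h₀ _).trans ((sum_conj_v₁ (onGen f ∘ₗ inV p) hb p).trans ?_)
      rw [CharP.cast_eq_zero, zero_smul]; rfl
    · refine (map_dX₃_vector f h₀ _).trans ((sum_conj_v₂ (onGen f ∘ₗ inV p) hb hc p).trans ?_)
      have h2 : 2 < p := lt_of_le_of_ne (Fact.out : p.Prime).two_le hp.symm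
      have : ((p.choose 2 : ℕ) : ZMod p) = 0 :=
        (ZMod.natCast_eq_zero_iff _ _).2 ((Fact.out : p.Prime).dvd_choose_self two_ne_zero h2)
      rw [this, CharP.cast_eq_zero (ZMod p) p, zero_smul, zero_smul, add_zero]; rfl
    · refine (defect b c x (euler b) hb hc hW).trans ?_
      rw [sub_self, map_zero, mul_zero, zero_mul]; rfl

/-- The coboundary of a cochain `F` of degree `-1` depends on `F` only through its value at `v₁`,
because `v₁` and `g` both commute with the value at `v₂`. -/
lemma onGen_comp_dX₂ (F : X₁ p →ₗ[Ae p] A p) {y : Fin p → ZMod p}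
    (h₀ : onGen F (1, 0) = 0) (hy : onGen F (0, v₁ p) = grp p y)
    (h₂ : onGen F (0, v₂ p) ∈ homogA p 0) :
    onGen (F ∘ₗ dX₂ p) (1, 0, 0) = 0 ∧ onGen (F ∘ₗ dX₂ p) (inV p (v₁ p)) = 0 ∧
      onGen (F ∘ₗ dX₂ p) (inV p (v₂ p)) = -(grp p y * ofG (g p)) ∧
      onGen (F ∘ₗ dX₂ p) (inW p (wedge (v₁ p) (v₂ p))) = ofV p (v₁ p) * grp p (euler y) := by
  obtain ⟨z, hz⟩ := exists_eq_grp h₂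
  have hV (v : V p) : onGen (F ∘ₗ dX₂ p) (inV p v)
      = ofG (g p) * onGen F (0, v) - onGen F (0, act (g p) v) * ofG (g p) := by
    rw [onGen_apply, LinearMap.comp_apply, dX₂, bimLift_gen]
    simp only [inV, LinearMap.comp_apply, LinearMap.inl_apply, LinearMap.inr_apply,
      LinearMap.coprod_apply, map_zero, zero_add, add_zero, LinearMap.sub_apply, map_sub, map_triL,
      map_koszul₁, h₀, mul_zero, zero_mul, sub_zero, one_mul, mul_one]
  have comm (x : Fin p → ZMod p) : ofG (g p) * grp p x = grp p x * ofG (g p) := by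
    simpa using ofG_comm_grp 1 x
  refine ⟨?_, ?_, ?_, ?_⟩
  · rw [onGen_apply, LinearMap.comp_apply, dX₂, bimLift_gen]
    simp only [LinearMap.coprod_apply, map_zero, add_zero, LinearMap.toSpanSingleton_apply,
      one_smul, map_sum]
    exact Finset.sum_eq_zero fun l _ => by rw [map_tri, ← onGen_apply, h₀, mul_zero, zero_mul]
  · rw [hV, act_g_v₁, hy, comm, sub_self]
  · have : ((0, v₂ p + v₁ p) : GenX₁ p) = (0, v₂ p) + (0, v₁ p) := by simp
    rw [hV, act_g_v₂, this, map_add, hy, hz, comm, add_mul]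
    abel
  · rw [onGen_apply, LinearMap.comp_apply, dX₂, bimLift_gen]
    simp only [inW, LinearMap.comp_apply, LinearMap.inr_apply, LinearMap.coprod_apply, map_zero,
      zero_add, map_koszul₂, act_one, LinearMap.id_apply, hy, hz, grp_mul_v₁, grp_mul_v₂]
    abel

/-- The coboundaries of degree `-1` on `X`, in coordinates. -/
lemma isCoboundaryX_iff (f : X₂ p →ₗ[Ae p] A p) :
    IsCoboundaryX f ↔ ∃ y : Fin p → ZMod p, onGen f (1, 0, 0) = 0 ∧
      onGen f (inV p (v₁ p)) = 0 ∧ onGen f (inV p (v₂ p)) = -(grp p y * ofG (g p)) ∧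
      onGen f (inW p (wedge (v₁ p) (v₂ p))) = ofV p (v₁ p) * grp p (euler y) := by
  constructor
  · rintro ⟨F, hF, rfl⟩
    rw [isDegNegOne_iff] at hF
    have h₀ : onGen F (1, 0) = 0 :=
      eq_zero_of_mem_homogA (by norm_num) (hF 0 (1, 0) (by simp [grX₁]))
    have hV (v : V p) : onGen F (0, v) ∈ homogA p 0 := hF 1 (0, v) (by simp [grX₁])
    obtain ⟨y, hy⟩ := exists_eq_grp (hV (v₁ p))
    exact ⟨y, onGen_comp_dX₂ F h₀ hy (hV _)⟩
  · rintro ⟨y, h₀, h₁, h₂, h₃⟩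
    -- Only the value `y` at `v₁` matters: the value at `v₂` cancels out of the coboundary.
    let φ : GenX₁ p →ₗ[ZMod p] A p :=
      LinearMap.coprod 0 (LinearMap.toSpanSingleton (ZMod p) (A p) (grp p y) ∘ₗ LinearMap.proj 0)
    have hφ (r : ZMod p) (v : V p) : onGen (bimLift φ) (r, v) = v 0 • grp p y := by
      rw [onGen_bimLift]; simp [φ]
    refine ⟨bimLift φ, (isDegNegOne_iff _ _).2 ?_, ?_⟩
    · rintro d ⟨r, v⟩ ⟨-, hv⟩
      rw [hφ]
      by_cases hd : d = 1
      · subst hd; exact Submodule.smul_mem _ _ (grp_mem_homogA y)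
      · rw [show v = 0 from hv hd, Pi.zero_apply, zero_smul]; exact zero_mem _
    · obtain ⟨k₀, k₁, k₂, k₃⟩ := onGen_comp_dX₂ (bimLift φ) (y := y)
        (by rw [hφ]; simp) (by rw [hφ]; simp [v₁])
        (by rw [hφ]; simp [v₂])
      exact genX₂_ext (h₀.trans k₀.symm) (h₁.trans k₁.symm) (h₂.trans k₂.symm) (h₃.trans k₃.symm)

/-! ### The distinguished cocycles -/

lemma gammaX_values (a b : Fin p → ZMod p) :
    onGen (gammaX a b) (1, 0, 0) = 0 ∧
      onGen (gammaX a b) (inV p (v₁ p)) = grp p b * ofG (g p) ∧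
      onGen (gammaX a b) (inV p (v₂ p)) = grp p (Function.update a 0 0) * ofG (g p) ∧
      onGen (gammaX a b) (inW p (wedge (v₁ p) (v₂ p)))
        = ofV p (v₁ p) * grp p (Pi.single 0 (a 0)) + ofV p (v₂ p) * grp p (euler b) := by
  rw [gammaX, onGen_bimLift]
  refine ⟨?_, ?_, ?_, ?_⟩
  · simp
  · simp [inV, v₁, grp_apply, Finset.sum_mul, ← ofG_mul, ← pow_succ]
  · simp [inV, v₂, grp_apply, Finset.sum_mul, ← ofG_mul, ← pow_succ, Finset.sum_filter,
      Function.update_apply, ite_not]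
  · rw [grp_single, grp_apply, Finset.mul_sum]
    simp [inW, wedgeLift_wedge, v₁, v₂, euler]

lemma isCocycleX_gammaX (hp : p ≠ 2) (a b : Fin p → ZMod p) : IsCocycleX (gammaX a b) :=
  (isCocycleX_iff hp _).2 ⟨b, _, _, gammaX_values a b⟩

/-- A coboundary changes the values at `v₂` and at `v₁ ∧ v₂` together. Hence the coefficients of
`v₁ gˡ` in the latter, for `l ≠ 0`, can be moved to the former in exactly one way. -/
lemma existsUnique_gammaX (hp : p ≠ 2) {f : X₂ p →ₗ[Ae p] A p} (hf : IsCocycleX f) :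
    ∃! ab : (Fin p → ZMod p) × (Fin p → ZMod p), IsCoboundaryX (f - gammaX ab.1 ab.2) := by
  obtain ⟨b, c, x, h₀, h₁, h₂, h₃⟩ := (isCocycleX_iff hp f).1 hf
  have key (a b' : Fin p → ZMod p) : IsCoboundaryX (f - gammaX a b') ↔ b' = b ∧
      ∃ y : Fin p → ZMod p, c - Function.update a 0 0 = -y ∧ x - Pi.single 0 (a 0) = euler y := by
    obtain ⟨k₀, k₁, k₂, k₃⟩ := gammaX_values a b'
    rw [isCoboundaryX_iff, onGen_sub]
    simp only [LinearMap.sub_apply, h₀, h₁, h₂, h₃, k₀, k₁, k₂, k₃, sub_self, true_and]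
    rw [← exists_and_left]
    refine exists_congr fun y => ?_
    constructor
    · rintro ⟨e₁, e₂, e₃⟩
      have hb : b' = b := (grp_injective (mul_ofG_cancel (sub_eq_zero.1 e₁))).symm
      refine ⟨hb, grp_injective (mul_ofG_cancel (h := g p) ?_),
        v₁_mul_grp_injective ?_⟩
      · rw [map_sub, map_neg, sub_mul, neg_mul, e₂]
      · subst hb
        simp only [map_sub, mul_sub, ← e₃]
        abel
    · rintro ⟨rfl, e₂, e₃⟩
      refine ⟨sub_self _, ?_, ?_⟩
      · rw [← sub_mul, ← map_sub, e₂, map_neg, neg_mul]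
      · rw [← e₃, map_sub, mul_sub]
        abel
  have hl {l : Fin p} (h : l ≠ 0) : ((l.val : ℕ) : ZMod p) ≠ 0 := by
    rw [Ne, ZMod.natCast_eq_zero_iff]
    exact fun hd => h (Fin.ext (Nat.eq_zero_of_dvd_of_lt hd l.2))
  -- The coboundary parameter `y` solves `l yₗ = xₗ` for `l ≠ 0`; its entry `y₀` is free in this
  -- equation and is used to remove the coefficient of `g` from the value at `v₂`.
  refine ⟨(fun l => if l = 0 then x 0 else c l + x l / (l.val : ZMod p), b), (key _ _).2 ⟨rfl,
    fun l => if l = 0 then -c 0 else x l / (l.val : ZMod p), ?_, ?_⟩, ?_⟩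
  · ext l
    by_cases h : l = 0
    · subst h; simp
    · simp [h]
  · ext l
    by_cases h : l = 0
    · subst h; simp [euler]
    · simp [h, euler, mul_div_cancel₀ _ (hl h)]
  · rintro ⟨a, b'⟩ hab
    obtain ⟨rfl, y, e₁, e₂⟩ := (key a b').1 hab
    refine Prod.ext (funext fun l => ?_) rfl
    have e₁l := congrFun e₁ l
    have e₂l := congrFun e₂ l
    by_cases h : l = 0
    · subst h
      simpa [euler, sub_eq_zero, eq_comm] using e₂l
    · simp only [Pi.sub_apply, Pi.neg_apply, euler, Function.update_of_ne h, Pi.single_eq_of_ne h,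
        sub_zero] at e₁l e₂l
      simp only [if_neg h]
      rw [e₂l, mul_div_cancel_left₀ _ (hl h)]
      linear_combination -e₁l

end complexX

/-! ### The transfer to the twisted product with the reduced bar resolution -/

section complexY

variable {p : ℕ}

lemma barLift₁_br {M N : Type} [AddCommGroup M] [Module (ZMod p) M] [AddCommGroup N]
    [Module (ZMod p) N] (φ : G p → M →ₗ[ZMod p] N) (hφ : φ 1 = 0) (h : G p) (m : M) :
    barLift₁ φ hφ (br h ⊗ₜ m) = φ h m := by
  simp [barLift₁]

lemma barLift₂_br {M N : Type} [AddCommGroup M] [Module (ZMod p) M] [AddCommGroup N]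
    [Module (ZMod p) N] (φ : G p → G p → M →ₗ[ZMod p] N) (hl : ∀ k, φ 1 k = 0)
    (hr : ∀ h, φ h 1 = 0) (h k : G p) (m : M) :
    barLift₂ φ hl hr (br h ⊗ₜ (br k ⊗ₜ m)) = φ h k m := by
  rw [barLift₂, barLift₁_br, barLift₁_br]

lemma barTensor_ext {M N : Type} [AddCommGroup M] [Module (ZMod p) M] [AddCommGroup N]
    [Module (ZMod p) N] {f f' : Gbar p ⊗[ZMod p] M →ₗ[ZMod p] N}
    (h : ∀ k m, f (br k ⊗ₜ m) = f' (br k ⊗ₜ m)) : f = f' :=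
  TensorProduct.ext (bar_ext fun k => LinearMap.ext fun m => h k m)

lemma map_dY₃₀ (f : Y₂ p →ₗ[Ae p] A p) (h₀ : ∀ h k, onGen f (genGG h k) = 0) (h k l : G p) :
    f (dY₃ p (tri 1 (br h ⊗ₜ (br k ⊗ₜ br l), 0, 0) 1)) = 0 := by
  rw [dY₃, bimLift_gen]
  simp only [LinearMap.coprod_apply, map_zero, add_zero, dY₃₀, barLift₂_br, barLift_br, map_sub,
    map_add, map_tri_one_left, map_tri_one_right, h₀, mul_zero, zero_mul, sub_zero]

lemma map_dY₂₁ (f : Y₂ p →ₗ[Ae p] A p) (h₀ : ∀ h k, onGen f (genGG h k) = 0) (h k : G p)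
    (v : V p) :
    f (dY₃ p (tri 1 (0, br h ⊗ₜ (br k ⊗ₜ v), 0) 1))
      = ofG h * onGen f (genGV k v) - onGen f (genGV (h * k) v)
        + onGen f (genGV h (act k v)) * ofG k := by
  rw [dY₃, bimLift_gen]
  simp only [LinearMap.coprod_apply, map_zero, zero_add, add_zero, dY₂₁, barLift₂_br,
    LinearMap.add_apply, LinearMap.sub_apply, LinearMap.comp_apply, map_add, map_sub, map_triL,
    map_koszul₁, h₀, mul_zero, zero_mul, sub_zero, one_mul, mul_one]

lemma map_dY₁₂ (f : Y₂ p →ₗ[Ae p] A p) (n : ℕ) :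
    f (dY₃ p (tri 1 (0, 0, br (g p ^ n) ⊗ₜ wedge (v₁ p) (v₂ p)) 1))
      = ofG (g p ^ n) * onGen f (genW p (wedge (v₁ p) (v₂ p)))
        - onGen f (genW p (wedge (v₁ p) (v₂ p))) * ofG (g p ^ n)
        - (ofV p (v₁ p) * onGen f (genGV (g p ^ n) (v₂ p))
            + onGen f (genGV (g p ^ n) (v₁ p)) * ofV p (v₂ p)
          - (ofV p (v₂ p + (n : ZMod p) • v₁ p) * onGen f (genGV (g p ^ n) (v₁ p))
            + onGen f (genGV (g p ^ n) (v₂ p)) * ofV p (v₁ p))) := by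
  rw [dY₃, bimLift_gen]
  simp only [LinearMap.coprod_apply, map_zero, zero_add, dY₁₂, barLift₁_br,
    LinearMap.sub_apply, LinearMap.comp_apply, map_sub, map_triL, map_koszul₂, actW_g_pow,
    act_g_pow_v₁, act_g_pow_v₂, one_mul, mul_one]

lemma comp_dY₃_eq_zero (f : Y₂ p →ₗ[Ae p] A p)
    (h₃₀ : ∀ h k l : G p, f (dY₃ p (tri 1 (br h ⊗ₜ (br k ⊗ₜ br l), 0, 0) 1)) = 0)
    (h₁ : ∀ h k : G p, f (dY₃ p (tri 1 (0, br h ⊗ₜ (br k ⊗ₜ v₁ p), 0) 1)) = 0)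
    (h₂ : ∀ h k : G p, f (dY₃ p (tri 1 (0, br h ⊗ₜ (br k ⊗ₜ v₂ p), 0) 1)) = 0)
    (h₁₂ : ∀ h : G p, f (dY₃ p (tri 1 (0, 0, br h ⊗ₜ wedge (v₁ p) (v₂ p)) 1)) = 0) :
    f ∘ₗ dY₃ p = 0 := by
  apply onGen_injective
  have hz : onGen (0 : Y₃ p →ₗ[Ae p] A p) = 0 := rfl
  rw [hz]
  refine LinearMap.prod_ext ?_ (LinearMap.prod_ext ?_ ?_)
  · exact TensorProduct.ext (bar_ext fun h => TensorProduct.ext (bar_ext fun k =>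
      bar_ext fun l => h₃₀ h k l))
  · exact TensorProduct.ext (bar_ext fun h => TensorProduct.ext (bar_ext fun k =>
      V_ext (h₁ h k) (h₂ h k)))
  · exact TensorProduct.ext (bar_ext fun h => W_ext (h₁₂ h))

lemma isDegNegOne_Y₂ (f : Y₂ p →ₗ[Ae p] A p) (h₀ : ∀ h k, onGen f (genGG h k) = 0)
    (h₁ : ∀ h v, onGen f (genGV h v) ∈ homogA p 0)
    (h₂ : onGen f (genW p (wedge (v₁ p) (v₂ p))) ∈ homogA p 1) : IsDegNegOne (grY₂ p) f := by
  rw [isDegNegOne_iff]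
  rintro d ⟨t, s, w⟩ ⟨-, hs, hw⟩
  have e : onGen f (t, s, w) = onGen f (t, 0, 0) + onGen f (0, s, 0) + onGen f (0, 0, w) := by
    rw [← map_add, ← map_add]; simp
  have ht : onGen f (t, 0, 0) = 0 := by
    have : onGen f ∘ₗ LinearMap.inl _ _ _ = 0 :=
      TensorProduct.ext (bar_ext fun h => bar_ext fun k => h₀ h k)
    exact LinearMap.congr_fun this t
  have hV : onGen f (0, s, 0) ∈ homogA p 0 := by
    have : (homogA p 0).mkQ ∘ₗ onGen f ∘ₗ LinearMap.inr _ _ _ ∘ₗ LinearMap.inl _ _ _ = 0 :=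
      barTensor_ext fun h v => (Submodule.Quotient.mk_eq_zero _).2 (h₁ h v)
    exact (Submodule.Quotient.mk_eq_zero _).1 (LinearMap.congr_fun this s)
  have hW : onGen f (0, 0, w) ∈ homogA p 1 := by
    have : (homogA p 1).mkQ ∘ₗ onGen f ∘ₗ genW p = 0 :=
      W_ext ((Submodule.Quotient.mk_eq_zero _).2 h₂)
    exact (Submodule.Quotient.mk_eq_zero _).1 (LinearMap.congr_fun this w)
  rw [e, ht, zero_add]
  refine add_mem ?_ ?_
  · by_cases hd : d = 1
    · subst hd; exact hV
    · rw [show s = 0 from hs hd]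
      exact ((onGen f).map_zero).symm ▸ zero_mem _
  · by_cases hd : d = 2
    · subst hd; exact hW
    · rw [show w = 0 from hw hd]
      exact ((onGen f).map_zero).symm ▸ zero_mem _

lemma two_mul_choose_two (n : ℕ) : (2 : ZMod p) * (n.choose 2 : ZMod p) = n * (n - 1) := by
  induction n with
  | zero => simp
  | succ n ih =>
    rw [Nat.choose_succ_succ' n 1, Nat.choose_one_right]
    push_cast
    linear_combination ih

variable [Fact p.Prime]

lemma two_ne_zero_zmod (hp : p ≠ 2) : (2 : ZMod p) ≠ 0 := by
  intro h
  have : ((2 : ℕ) : ZMod p) = 0 := by exact_mod_cast h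
  rw [ZMod.natCast_eq_zero_iff, Nat.prime_dvd_prime_iff_eq Fact.out Nat.prime_two] at this
  exact hp this

lemma choose_two_congr (hp : p ≠ 2) {m n : ℕ} (h : (m : ZMod p) = n) :
    (m.choose 2 : ZMod p) = n.choose 2 := by
  refine mul_left_cancel₀ (two_ne_zero_zmod hp) ?_
  rw [two_mul_choose_two, two_mul_choose_two, h]

lemma choose_two_add (hp : p ≠ 2) (m n : ℕ) :
    ((m + n).choose 2 : ZMod p) = m.choose 2 + n.choose 2 + (m : ZMod p) * n := by
  refine mul_left_cancel₀ (two_ne_zero_zmod hp) ?_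
  have h₁ := two_mul_choose_two (p := p) m
  have h₂ := two_mul_choose_two (p := p) n
  rw [two_mul_choose_two]
  push_cast
  linear_combination -h₁ - h₂

lemma cast_expo_g_pow (n : ℕ) : (expo (g p ^ n) : ZMod p) = n := by
  have h : g p ^ n = g p ^ (n % p) := by
    conv_lhs => rw [← Nat.mod_add_div n p, pow_add, pow_mul, g_pow_p, one_pow, mul_one]
  rw [h, expo_g_pow (Nat.mod_lt _ (Fact.out : p.Prime).pos), ZMod.natCast_mod]

lemma transfer_genGG (f : X₂ p →ₗ[Ae p] A p) (h₀ : onGen f (1, 0, 0) = 0) (h k : G p) :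
    onGen (f ∘ₗ pi₂ p) (genGG h k) = 0 := by
  rw [onGen_apply, LinearMap.comp_apply, pi₂, bimLift_gen, genGG]
  simp only [LinearMap.coprod_apply, map_zero, add_zero, pi₂₀, barLift₁_br, barLift_br]
  split_ifs
  · rw [map_tri_one_left, h₀, zero_mul]
  · exact map_zero f

lemma transfer_genGV (f : X₂ p →ₗ[Ae p] A p) (h : G p) (v : V p) :
    onGen (f ∘ₗ pi₂ p) (genGV h v) = ∑ l ∈ Finset.range (expo h),
      ofG (g p ^ (expo h - 1 - l)) * (onGen f ∘ₗ inV p) (act (g p ^ l) v) * ofG (g p ^ l) := by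
  rw [onGen_apply, LinearMap.comp_apply, pi₂, bimLift_gen]
  simp only [genGV, LinearMap.comp_apply, LinearMap.inl_apply, LinearMap.inr_apply,
    TensorProduct.mk_apply, LinearMap.coprod_apply, map_zero, zero_add, add_zero, pi₁₁, barLift₁_br,
    LinearMap.sum_apply, map_sum, map_triL]

lemma transfer_genW (f : X₂ p →ₗ[Ae p] A p) (w : ⋀[ZMod p]^2 (V p)) :
    onGen (f ∘ₗ pi₂ p) (genW p w) = onGen f (inW p w) := by
  rw [onGen_apply, LinearMap.comp_apply, pi₂, bimLift_gen]
  simp only [genW, LinearMap.comp_apply, LinearMap.inr_apply, LinearMap.coprod_apply, map_zero,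
    zero_add, map_triL, one_mul, mul_one]

lemma transfer_genGV_v₁ (f : X₂ p →ₗ[Ae p] A p) {b : Fin p → ZMod p}
    (hb : onGen f (inV p (v₁ p)) = grp p b * ofG (g p)) (n : ℕ) :
    onGen (f ∘ₗ pi₂ p) (genGV (g p ^ n) (v₁ p)) = (n : ZMod p) • (grp p b * ofG (g p ^ n)) := by
  rw [transfer_genGV, sum_conj_v₁ (onGen f ∘ₗ inV p) hb, cast_expo_g_pow, g_pow_expo]

/-- The exponent of `gⁿ` is only congruent to `n` modulo `p`, which suffices as `p` is odd. -/
lemma transfer_genGV_v₂ (hp : p ≠ 2) (f : X₂ p →ₗ[Ae p] A p) {b c : Fin p → ZMod p}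
    (hb : onGen f (inV p (v₁ p)) = grp p b * ofG (g p))
    (hc : onGen f (inV p (v₂ p)) = grp p c * ofG (g p)) (n : ℕ) :
    onGen (f ∘ₗ pi₂ p) (genGV (g p ^ n) (v₂ p))
      = (n.choose 2 : ZMod p) • (grp p b * ofG (g p ^ n))
        + (n : ZMod p) • (grp p c * ofG (g p ^ n)) := by
  rw [transfer_genGV, sum_conj_v₂ (onGen f ∘ₗ inV p) hb hc,
    choose_two_congr hp (cast_expo_g_pow n), cast_expo_g_pow, g_pow_expo]

/-- Instead of using that `π₂` is part of a chain map, the three parts of the cocycle condition on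
`Y₃` are read off the values of the transferred cochain. -/
lemma isCocycleY_transfer (hp : p ≠ 2) {f : X₂ p →ₗ[Ae p] A p} (hf : IsCocycleX f) :
    IsCocycleY (f ∘ₗ pi₂ p) := by
  obtain ⟨b, c, x, h₀, hb, hc, hW⟩ := (isCocycleX_iff hp f).1 hf
  have hGG := transfer_genGG f h₀
  have hG₁ := transfer_genGV_v₁ f hb
  have hG₂ := transfer_genGV_v₂ hp f hb hc
  have left (m n : ℕ) (z : Fin p → ZMod p) :
      ofG (g p ^ m) * (grp p z * ofG (g p ^ n)) = grp p z * ofG (g p ^ (m + n)) := by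
    rw [← mul_assoc, ofG_comm_grp, mul_assoc, ← ofG_mul, ← pow_add]
  have right (m n : ℕ) (z : Fin p → ZMod p) :
      grp p z * ofG (g p ^ m) * ofG (g p ^ n) = grp p z * ofG (g p ^ (m + n)) := by
    rw [mul_assoc, ← ofG_mul, ← pow_add]
  refine ⟨isDegNegOne_Y₂ _ hGG (fun h v => ?_) ?_,
    comp_dY₃_eq_zero _ (map_dY₃₀ _ hGG) (fun h k => ?_) (fun h k => ?_) (fun h => ?_)⟩
  · obtain ⟨n, -, rfl⟩ := exists_pow h
    have : (homogA p 0).mkQ ∘ₗ onGen (f ∘ₗ pi₂ p) ∘ₗ genGV (g p ^ n) = 0 := by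
      have hm (z : Fin p → ZMod p) : grp p z * ofG (g p ^ n) ∈ homogA p 0 :=
        mul_mem_homogA (grp_mem_homogA z) (ofG_mem_homogA _)
      refine V_ext ((Submodule.Quotient.mk_eq_zero _).2 ?_)
        ((Submodule.Quotient.mk_eq_zero _).2 ?_)
      · rw [LinearMap.comp_apply, hG₁]
        exact Submodule.smul_mem _ _ (hm b)
      · rw [LinearMap.comp_apply, hG₂]
        exact add_mem (Submodule.smul_mem _ _ (hm b)) (Submodule.smul_mem _ _ (hm c))
    exact (Submodule.Quotient.mk_eq_zero _).1 (LinearMap.congr_fun this v)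
  · rw [transfer_genW, hW]
    exact add_mem (v_mul_grp_mem_homogA _ _) (v_mul_grp_mem_homogA _ _)
  · obtain ⟨m, -, rfl⟩ := exists_pow h
    obtain ⟨n, -, rfl⟩ := exists_pow k
    rw [map_dY₂₁ _ hGG, act_g_pow_v₁, ← pow_add, hG₁, hG₁, hG₁, mul_smul_comm, smul_mul_assoc, left,
      right, Nat.cast_add]
    module
  · obtain ⟨m, -, rfl⟩ := exists_pow h
    obtain ⟨n, -, rfl⟩ := exists_pow k
    rw [map_dY₂₁ _ hGG, act_g_pow_v₂, (genGV (g p ^ m)).map_add, (genGV (g p ^ m)).map_smul,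
      (onGen (f ∘ₗ pi₂ p)).map_add, (onGen (f ∘ₗ pi₂ p)).map_smul, ← pow_add, hG₁, hG₂,
      hG₂, hG₂, choose_two_add hp]
    simp only [mul_add, add_mul, mul_smul_comm, smul_mul_assoc, left, right, Nat.cast_add]
    module
  · obtain ⟨n, -, rfl⟩ := exists_pow h
    have hc' : (n.choose 2 : ZMod p) • (grp p b * ofG (g p ^ n))
        + (n : ZMod p) • (grp p c * ofG (g p ^ n))
        = grp p ((n.choose 2 : ZMod p) • b + (n : ZMod p) • c) * ofG (g p ^ n) := by
      rw [map_add, map_smul, map_smul, add_mul, smul_mul_assoc, smul_mul_assoc]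
    have h₁ := hG₁ n
    have h₂ := (hG₂ n).trans hc'
    have h₃ := (transfer_genW f (wedge (v₁ p) (v₂ p))).trans hW
    refine (map_dY₁₂ _ n).trans ?_
    simp only [h₁, h₂, h₃]
    rw [koszul_defect, sub_self, map_zero, mul_zero, zero_mul, smul_zero]

end complexY

end TransvectionHH

end

theorem mainTheorem9 (p : ℕ) [Fact p.Prime] (hp : p ≠ 2) :
    -- the distinguished 2-cochains on `X` are cocycles of graded degree `-1` ...
    (∀ a b : Fin p → ZMod p, IsCocycleX (gammaX a b)) ∧
    -- ... and each class in `HH²₋₁(A)` has exactly one distinguished representative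
    (∀ c : X₂ p →ₗ[Ae p] A p, IsCocycleX c →
      ∃! ab : (Fin p → ZMod p) × (Fin p → ZMod p), IsCoboundaryX (c - gammaX ab.1 ab.2)) ∧
    -- their transfers `γ = γ_X ∘ π₂` to `Y` are cocycles of the stated form
    (∀ (a b : Fin p → ZMod p) (γ : Y₂ p →ₗ[Ae p] A p), γ = gammaX a b ∘ₗ pi₂ p →
      IsCocycleY γ ∧
      (∀ i < p, ∀ j < p, γ (tri 1 (genGG (g p ^ i) (g p ^ j)) 1) = 0) ∧
      (∀ i < p, γ (tri 1 (genGV (g p ^ i) (v₁ p)) 1)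
        = (i : ZMod p) • ((∑ l : Fin p, b l • ofG (g p ^ l.val)) * ofG (g p ^ i))) ∧
      (∀ i < p, γ (tri 1 (genGV (g p ^ i) (v₂ p)) 1)
        = (i.choose 2 : ZMod p) • ((∑ l : Fin p, b l • ofG (g p ^ l.val)) * ofG (g p ^ i))
          + (i : ZMod p) •
            ((∑ l ∈ Finset.univ.filter (fun l : Fin p => l ≠ 0), a l • ofG (g p ^ l.val))
              * ofG (g p ^ i))) ∧
      γ (tri 1 (genW p (wedge (v₁ p) (v₂ p))) 1)
        = a 0 • ofV p (v₁ p)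
          + ∑ l : Fin p, ((l.val : ZMod p) * b l) • (ofV p (v₂ p) * ofG (g p ^ l.val))) := by
  refine ⟨isCocycleX_gammaX hp, fun c hc => existsUnique_gammaX hp hc, ?_⟩
  rintro a b γ rfl
  obtain ⟨h₀, hb, hc, hW⟩ := gammaX_values a b
  refine ⟨isCocycleY_transfer hp (isCocycleX_gammaX hp a b),
    fun i _ j _ => transfer_genGG _ h₀ _ _, fun i _ => ?_, fun i _ => ?_, ?_⟩
  · rw [← grp_apply]
    exact transfer_genGV_v₁ _ hb i
  · have ha : ∑ l ∈ Finset.univ.filter (fun l : Fin p => l ≠ 0), a l • ofG (g p ^ l.val)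
        = grp p (Function.update a 0 0) := by
      simp [grp_apply, Finset.sum_filter, Function.update_apply, ite_not]
    rw [← grp_apply, ha]
    exact transfer_genGV_v₂ hp _ hb hc i
  · refine (transfer_genW _ _).trans (hW.trans ?_)
    rw [grp_single, mul_smul_comm, mul_one, grp_apply, Finset.mul_sum]
    simp only [mul_smul_comm, euler]
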